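/- Let $L$ be a Lie algebra of finite dimension $m$ over an algebraically closed field $K$, let $l_1,\dots,l_m$ be a basis of $L$, and let $k\ge 0$ be an integer. For an $(m-k)\times m$ matrix $a=(a_{ij})$ over $K$ let $\langle a\rangle\subseteq L$ be the $K$-span of the vectors $\sum_{j} a_{ij}l_j$, $1\le i\le m-k$. Let $M_k(L)$ be the set of those matrices $a$ in the affine space $K^{(m-k)\times m}$ for which $\langle a\rangle$ is a Lie subalgebra of $L$ ($M_k(L)=\emptyset$ if $k>m$), and let $M_k^0(L)\subseteq M_k(L)$ be the subset of those $a$ for which the vectors $\sum_j a_{ij}l_j$ are linearly dependent; thus for $a\in M_k(L)$ the subalgebra $\langle a\rangle$ has codimension $k$ if and only if $a\notin M_k^0(L)$. Consider the following two conditions. (i) There are a field $R$ that is a $K$-algebra and an injective homomorphism of Lie algebras $\varphi\colon L\to \mathrm{Der}_K R$ such that the $R$-subspace $R\varphi(L)$ of $\mathrm{Der}_K R$ spanned by $\varphi(L)$ satisfies $\dim_R R\varphi(L)=k$. (ii) There is an irreducible Zariski closed subset $V$ of the affine space $K^{(m-k)\times m}$ with $V\subseteq M_k(L)$ and $V\not\subseteq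 M_k^0(L)$ such that the codimension-$k$ subalgebras attached to points of $V$ intersect in zero: $\bigcap_{a\in V\setminus M_k^0(L)}\langle a\rangle=\{0\}$. Then (i) implies (ii). If moreover $K$ has characteristic $0$, then (i) and (ii) are equivalent. -/

import Mathlib

open Module

universe u v w

/-- The Zariski topology on the affine space `σ → K`: the closed sets are the zero loci of ideals
of polynomials over `K`. -/
@[reducible] def zariskiTop (σ K : Type*) [Field K] : TopologicalSpace (σ → K) :=
  TopologicalSpace.ofClosed {Z | ∃ I : Ideal (MvPolynomial σ K), Z = MvPolynomial.zeroLocus K I}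
    ⟨⊤, by simp⟩
    (by
      intro A hA
      refine ⟨MvPolynomial.vanishingIdeal K (⋂₀ A), ?_⟩
      refine Set.Subset.antisymm (MvPolynomial.zeroLocus_vanishingIdeal_le _) ?_
      rintro x hx Z hZ
      obtain ⟨I, rfl⟩ := hA hZ
      intro p hp
      exact hx p fun y hy => hy _ hZ p hp)
    (by
      rintro _ ⟨I, rfl⟩ _ ⟨J, rfl⟩
      refine ⟨I * J, ?_⟩
      ext x
      constructor
      · rintro (h | h) p hp
        · exact h p ((Ideal.mul_le_left : I * J ≤ I) hp)
        · exact h p ((Ideal.mul_le_right : I * J ≤ J) hp)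
      · intro h
        by_contra hx
        simp only [Set.mem_union, MvPolynomial.mem_zeroLocus_iff, not_or, not_forall] at hx
        obtain ⟨⟨p, hp, hp0⟩, ⟨q, hq, hq0⟩⟩ := hx
        have hpq := h (p * q) (Ideal.mul_mem_mul hp hq)
        rw [map_mul] at hpq
        exact (mul_ne_zero hp0 hq0) hpq)

/-- An irreducible closed subvariety of the affine space `σ → K` (as a set of points; in
particular it is nonempty). -/
def IsIrreducibleVariety {σ K : Type*} [Field K] (V : Set (σ → K)) : Prop :=
  @IsClosed (σ → K) (zariskiTop σ K) V ∧ @IsIrreducible (σ → K) (zariskiTop σ K) V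

section SubalgebraBases

variable {K : Type*} {L : Type*} [Field K] [LieRing L] [LieAlgebra K L] {m d : ℕ}

/-- The `i`-th vector `∑ j, a i j • b j` encoded by a `d × m` matrix `a`, where `b` is a basis
of `L`. -/
noncomputable def rowVec (b : Basis (Fin m) K L) (a : Fin d × Fin m → K) (i : Fin d) : L :=
  ∑ j, a (i, j) • b j

/-- The `K`-subspace of `L` spanned by the rows of the matrix `a`; for a point `a` of
`subalgebraBases b k` it is the subalgebra associated to `a`. -/
noncomputable def rowSpan (b : Basis (Fin m) K L) (a : Fin d × Fin m → K) : Submodule K L :=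
  Submodule.span K (Set.range (rowVec b a))

/-- `M_k(L)`: the `(m - k) × m` matrices whose rows span a Lie subalgebra of `L`, where
`m = dim L`. It is empty when `k > m` (there the number `m - k` of rows is meaningless). -/
def subalgebraBases (b : Basis (Fin m) K L) (k : ℕ) : Set (Fin (m - k) × Fin m → K) :=
  {a | k ≤ m ∧ ∃ H : LieSubalgebra K L, H.toSubmodule = rowSpan b a}

/-- `M_k^0(L)`: the points of `M_k(L)` whose rows are linearly dependent. -/
def degenerateSubalgebraBases (b : Basis (Fin m) K L) (k : ℕ) :
    Set (Fin (m - k) × Fin m → K) :=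
  {a | a ∈ subalgebraBases b k ∧ ¬ LinearIndependent K (rowVec b a)}

end SubalgebraBases

/-- There are a field `R` over `K` and an injective homomorphism of Lie algebras
`φ : L → Der_K R` such that the `R`-span of `φ(L)` has `R`-dimension `k`. -/
def HasFieldRealization (K : Type u) (L : Type v) [Field K] [LieRing L] [LieAlgebra K L]
    (k : ℕ) : Prop :=
  ∃ (R : Type max u w) (_ : Field R) (_ : Algebra K R) (φ : L →ₗ⁅K⁆ Derivation K R R),
    Function.Injective φ ∧ Module.rank R (Submodule.span R (Set.range φ)) = k

/-- `M_k(L)` contains an irreducible subvariety `V`, not contained in `M_k^0(L)`, such that the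
subalgebras of codimension `k` associated to the points of `V` (that is, to those points of `V`
that lie outside `M_k^0(L)`) intersect in `0`. -/
def HasSeparatingSubvariety {K : Type u} {L : Type v} [Field K] [LieRing L] [LieAlgebra K L]
    {m : ℕ} (b : Basis (Fin m) K L) (k : ℕ) : Prop :=
  ∃ V : Set (Fin (m - k) × Fin m → K),
    IsIrreducibleVariety V ∧ V ⊆ subalgebraBases b k ∧ ¬ V ⊆ degenerateSubalgebraBases b k ∧
      ⨅ a ∈ V \ degenerateSubalgebraBases b k, rowSpan b a = ⊥

/-! ### Functoriality and Leibniz rules on scalar extensions of a Lie algebra -/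

section BaseChange

open scoped TensorProduct

variable {K L A B : Type*} [CommRing K] [LieRing L] [LieAlgebra K L]
  [CommRing A] [Algebra K A] [CommRing B] [Algebra K B]

/-! Both conditions are compared with a third one: over some field `F` containing `K`, the Lie
algebra `F ⊗ L` has a subalgebra `W` of codimension `k` that meets `1 ⊗ L` in zero.

A realization over `R` gives such a `W` with `F = R`, namely the kernel of the `R`-linear extension
`R ⊗ L → Der_K R` of `φ` (`exists_lie_mem_of_realization`).

Subalgebras over `F` and subvarieties over `K` are exchanged through generic points. A matrix `A`
over `F` whose rows span `W` is a generic point of its locus over `K`, and an irreducible `V` has a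
generic point over its function field. Closure under the bracket, independence of the rows and
membership of a fixed vector of `L` in the row space are polynomial conditions, so they pass between
the generic point and the points of full rank (`mem_rowSpan_of_generic`, `generic_mem_rowSpan`).

In characteristic zero `W` gives back a realization by the formal version of the action of a group
`G` on `G/H`, with `H` the subgroup of `W` (`hasFieldRealization_of_extendPi`). For a complement of
`W` with basis `e i` in `L`, the chart is `g = exp (t • ∑ x i • e i)`. The frame `θ i = g⁻¹ ∂ᵢ g`
and the transport `c v = Ad(g⁻¹) v` are power series in `t` over `F[x]`, obtained from linear
differential equations in `t` (`exists_formal_frame`). Reading `c v` modulo `W` in the frame `θ`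
gives, up to sign, the vector field of `v` on `G/H` (`exists_realization_of_frame`); its
coefficients lie in the fraction field of `F[x]⟦t⟧`. -/

lemma AlgHom.rTensor_lie (f : A →ₐ[K] B) (x y : A ⊗[K] L) :
    f.toLinearMap.rTensor L ⁅x, y⁆ = ⁅f.toLinearMap.rTensor L x, f.toLinearMap.rTensor L y⁆ := by
  induction x with
  | zero => simp
  | add x₁ x₂ h₁ h₂ => simp only [add_lie, map_add, h₁, h₂]
  | tmul a u =>
    induction y with
    | zero => simp
    | add x₁ x₂ h₁ h₂ => simp only [lie_add, map_add, h₁, h₂]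
    | tmul c v => simp [LieAlgebra.ExtendScalars.bracket_tmul]

lemma Derivation.rTensor_lie (D : Derivation K A A) (x y : A ⊗[K] L) :
    (D : A →ₗ[K] A).rTensor L ⁅x, y⁆ =
      ⁅(D : A →ₗ[K] A).rTensor L x, y⁆ + ⁅x, (D : A →ₗ[K] A).rTensor L y⁆ := by
  induction x with
  | zero => simp
  | add x₁ x₂ h₁ h₂ => simp only [add_lie, map_add, h₁, h₂]; abel
  | tmul a u =>
    induction y with
    | zero => simp
    | add x₁ x₂ h₁ h₂ => simp only [lie_add, map_add, h₁, h₂]; abel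
    | tmul c v =>
      simp [LieAlgebra.ExtendScalars.bracket_tmul, ← TensorProduct.add_tmul]
      ring_nf

lemma Derivation.rTensor_smul (D : Derivation K A A) (a : A) (y : A ⊗[K] L) :
    (D : A →ₗ[K] A).rTensor L (a • y) = D a • y + a • (D : A →ₗ[K] A).rTensor L y := by
  induction y with
  | zero => simp
  | add x₁ x₂ h₁ h₂ => simp only [smul_add, map_add, h₁, h₂]; abel
  | tmul c v =>
    simp [TensorProduct.smul_tmul', ← TensorProduct.add_tmul]
    ring_nf

end BaseChange

/-! ### Subalgebras as kernels of coordinate maps, and their scalar extension -/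

section Coordinates

open scoped TensorProduct

variable {K F L ι : Type*} [CommRing K] [CommRing F] [Algebra K F] [LieRing L] [LieAlgebra K L]

/-- The `B`-linear extension `B ⊗ L → B ^ ι` of a `K`-linear map `L → F ^ ι`, for an
`F`-algebra `B`. -/
noncomputable def extendPi (p : L →ₗ[K] (ι → F)) (B : Type*) [CommRing B] [Algebra K B]
    [Algebra F B] [IsScalarTower K F B] : B ⊗[K] L →ₗ[B] (ι → B) :=
  LinearMap.liftBaseChange B
    (((IsScalarTower.toAlgHom K F B).toLinearMap.compLeft ι).comp p)

variable (p : L →ₗ[K] (ι → F)) {B B' : Type*} [CommRing B] [Algebra K B]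
    [Algebra F B] [IsScalarTower K F B] [CommRing B'] [Algebra K B']
    [Algebra F B'] [IsScalarTower K F B']

@[simp]
lemma extendPi_tmul (r : B) (v : L) (i : ι) :
    extendPi p B (r ⊗ₜ v) i = r * algebraMap F B (p v i) := by
  simp [extendPi]

/-- Since `p` has values in `F`, its extension commutes with every `F`-linear map of coefficients.
This is used for ring inclusions, for coefficients of power series and for `F`-derivations, which
therefore preserve the kernel. -/
lemma extendPi_rTensor (g : B →ₗ[F] B') (y : B ⊗[K] L) (i : ι) :
    extendPi p B' ((g.restrictScalars K).rTensor L y) i = g (extendPi p B y i) := by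
  induction y with
  | zero => simp
  | add x₁ x₂ h₁ h₂ => simp only [map_add, h₁, h₂, Pi.add_apply]
  | tmul c v =>
    simp only [LinearMap.rTensor_tmul, LinearMap.coe_restrictScalars, extendPi_tmul]
    rw [mul_comm, ← Algebra.smul_def, ← map_smul, Algebra.smul_def, mul_comm]

/-- The projection of `B ⊗ L` to the kernel of `extendPi p B` along the vectors `e i`. -/
noncomputable def extendPiCompl [Fintype ι] (e : ι → L) (B : Type*) [CommRing B] [Algebra K B]
    [Algebra F B] [IsScalarTower K F B] (z : B ⊗[K] L) : B ⊗[K] L :=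
  z - ∑ i, extendPi p B z i • ((1 : B) ⊗ₜ[K] e i)

/-- If the kernel of the extension of `p` to `F ⊗ L` is closed under the bracket, so is the kernel
of its extension to `B ⊗ L`. -/
lemma extendPi_lie_eq_zero [Fintype ι] [DecidableEq ι] {e : ι → L}
    (he : ∀ i, p (e i) = Pi.single i 1)
    (hp : ∀ x y : F ⊗[K] L, extendPi p F x = 0 → extendPi p F y = 0 → extendPi p F ⁅x, y⁆ = 0)
    {x y : B ⊗[K] L} (hx : extendPi p B x = 0) (hy : extendPi p B y = 0) :
    extendPi p B ⁅x, y⁆ = 0 := by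
  have hadd (z₁ z₂ : B ⊗[K] L) :
      extendPiCompl p e B (z₁ + z₂) = extendPiCompl p e B z₁ + extendPiCompl p e B z₂ := by
    simp only [extendPiCompl, map_add, Pi.add_apply, add_smul, Finset.sum_add_distrib]; abel
  have hsmul (r : B) (z : B ⊗[K] L) : extendPiCompl p e B (r • z) = r • extendPiCompl p e B z := by
    simp only [extendPiCompl, map_smul, Pi.smul_apply, smul_eq_mul, mul_smul, smul_sub,
      Finset.smul_sum]
  have hker (z : F ⊗[K] L) : extendPi p F (extendPiCompl p e F z) = 0 := by
    ext j
    simp [extendPiCompl, he, Finset.sum_apply, Pi.single_apply]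
  have hmap (v : L) : extendPiCompl p e B (1 ⊗ₜ v) =
      ((Algebra.linearMap F B).restrictScalars K).rTensor L (extendPiCompl p e F (1 ⊗ₜ v)) := by
    simp [extendPiCompl, TensorProduct.smul_tmul', Algebra.algebraMap_eq_smul_one]
  have hlie (z₁ z₂ : F ⊗[K] L) : ((Algebra.linearMap F B).restrictScalars K).rTensor L ⁅z₁, z₂⁆ =
      ⁅((Algebra.linearMap F B).restrictScalars K).rTensor L z₁,
        ((Algebra.linearMap F B).restrictScalars K).rTensor L z₂⁆ :=
    (IsScalarTower.toAlgHom K F B).rTensor_lie z₁ z₂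
  -- The projection is `B`-linear and fixes the kernel, so only brackets of projections of `1 ⊗ v`
  -- matter. These come from `F ⊗ L`, where `hp` applies.
  have key (z₁ z₂ : B ⊗[K] L) :
      extendPi p B ⁅extendPiCompl p e B z₁, extendPiCompl p e B z₂⁆ = 0 := by
    induction z₁ with
    | zero => simp [extendPiCompl]
    | add x₁ x₂ h₁ h₂ => rw [hadd, add_lie, map_add, h₁, h₂, add_zero]
    | tmul a u =>
      induction z₂ with
      | zero => simp [extendPiCompl]
      | add x₁ x₂ h₁ h₂ => rw [hadd, lie_add, map_add, h₁, h₂, add_zero]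
      | tmul c v =>
        have h (r : B) (z : L) : r ⊗ₜ[K] z = r • ((1 : B) ⊗ₜ[K] z) := by
          simp [TensorProduct.smul_tmul']
        rw [h a, h c, hsmul, hsmul, smul_lie, lie_smul, map_smul, map_smul, hmap, hmap, ← hlie]
        have : extendPi p B (((Algebra.linearMap F B).restrictScalars K).rTensor L
            ⁅extendPiCompl p e F (1 ⊗ₜ u), extendPiCompl p e F (1 ⊗ₜ v)⁆) = 0 := by
          ext i
          rw [extendPi_rTensor, hp _ _ (hker _) (hker _)]
          simp
        rw [this, smul_zero, smul_zero]
  have := key x y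
  simpa [extendPiCompl, hx, hy] using this

end Coordinates

/-! ### From a Maurer-Cartan frame to vector fields on the quotient -/

section Frame

open scoped TensorProduct

variable {K L R ι : Type*} [Field K] [LieRing L] [LieAlgebra K L] [Field R] [Algebra K R]
  [Fintype ι]

lemma Derivation.linearCombination_apply (D : ι → Derivation K R R) (f : ι → R) (s : R) :
    Fintype.linearCombination R D f s = ∑ i, f i * D i s := by
  rw [Fintype.linearCombination_apply, ← Derivation.coeFnAddMonoidHom_apply, map_sum,
    Finset.sum_apply]
  rfl

/-- The Lie bracket of two combinations of commuting derivations. -/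
lemma Derivation.lie_linearCombination {D : ι → Derivation K R R}
    (hcomm : ∀ i j, ⁅D i, D j⁆ = 0) (f g : ι → R) :
    ⁅Fintype.linearCombination R D f, Fintype.linearCombination R D g⁆ =
      Fintype.linearCombination R D (fun j => Fintype.linearCombination R D f (g j) -
        Fintype.linearCombination R D g (f j)) := by
  ext r
  have hc (i j : ι) (r : R) : D i (D j r) = D j (D i r) := by
    have := DFunLike.congr_fun (hcomm i j) r
    rwa [Derivation.commutator_apply, Derivation.zero_apply, sub_eq_zero] at this
  simp only [Derivation.commutator_apply, linearCombination_apply, map_sum, Derivation.leibniz, smul_eq_mul, sub_mul,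
    Finset.sum_sub_distrib, Finset.sum_add_distrib, Finset.mul_sum, Finset.sum_mul]
  have h₁ : ∑ i, ∑ j, g i * (f j * D j (D i r)) = ∑ i, ∑ j, f i * (g j * D j (D i r)) := by
    rw [Finset.sum_comm]
    refine Finset.sum_congr rfl fun i _ => Finset.sum_congr rfl fun j _ => ?_
    rw [hc]; ring
  rw [h₁, add_sub_add_left_eq_sub]
  congr 1 <;>
  · refine Finset.sum_congr rfl fun i _ => Finset.sum_congr rfl fun j _ => ?_
    ring

lemma Derivation.rTensor_linearCombination (D : ι → Derivation K R R) (f : ι → R) (y : R ⊗[K] L) :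
    (Fintype.linearCombination R D f : R →ₗ[K] R).rTensor L y =
      ∑ i, f i • (D i : R →ₗ[K] R).rTensor L y := by
  induction y with
  | zero => simp
  | add y z hy hz => simp only [map_add, hy, hz, smul_add, Finset.sum_add_distrib]
  | tmul r v =>
    simp [linearCombination_apply, TensorProduct.sum_tmul, TensorProduct.smul_tmul']

/-- A moving frame `θ` and an adjoint transport `c` satisfying the Maurer-Cartan equations give
a realization of `L` by derivations of `R`. -/
theorem exists_realization_of_frame [DecidableEq ι] {D : ι → Derivation K R R} (hcomm : ∀ i j, ⁅D i, D j⁆ = 0)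
    {x : ι → R} (hx : ∀ i j, D i (x j) = if i = j then 1 else 0)
    {ξ : R ⊗[K] L →ₗ[R] (ι → R)} (hξlie : ∀ y z, ξ y = 0 → ξ z = 0 → ξ ⁅y, z⁆ = 0)
    (hξD : ∀ i y, ξ y = 0 → ξ ((D i : R →ₗ[K] R).rTensor L y) = 0)
    {θ : ι → R ⊗[K] L} (hθ : ∀ i, ξ (θ i) = Pi.single i 1)
    {c : L →ₗ[K] R ⊗[K] L} (hclie : ∀ u v, c ⁅u, v⁆ = ⁅c u, c v⁆)
    (hc : ∀ i v, (D i : R →ₗ[K] R).rTensor L (c v) = -⁅θ i, c v⁆)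
    (hMC : ∀ i j, (D i : R →ₗ[K] R).rTensor L (θ j) - (D j : R →ₗ[K] R).rTensor L (θ i) =
      -⁅θ i, θ j⁆)
    (hspan : Submodule.span R (Set.range fun v => ξ (c v)) = ⊤) (hinj : ∀ v, ξ (c v) = 0 → v = 0) :
    ∃ φ : L →ₗ⁅K⁆ Derivation K R R, Function.Injective φ ∧
      Module.rank R (Submodule.span R (Set.range φ)) = Fintype.card ι := by
  set X : (ι → R) →ₗ[R] Derivation K R R := Fintype.linearCombination R D with hX
  have hXinj : Function.Injective X := by
    refine (injective_iff_map_eq_zero X).2 fun f hf => funext fun j => ?_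
    have := DFunLike.congr_fun hf (x j)
    rw [hX, Derivation.linearCombination_apply] at this
    simpa [hx] using this
  have htheta (f : ι → R) : ξ (∑ i, f i • θ i) = f := by
    ext j
    simp [hθ, Finset.sum_apply, Pi.single_apply]
  -- Replace `c u` and `c v` by `A` and `B`, their components along the frame. The equations for `c`
  -- and `θ` turn the difference of the two sides into `ξ ⁅c u - A, c v - B⁆`, which vanishes
  -- because both entries lie in the subalgebra `ker ξ`.
  have hmain (u v : L) : (fun j => X (ξ (c u)) (ξ (c v) j) - X (ξ (c v)) (ξ (c u) j)) =
      -ξ (c ⁅u, v⁆) := by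
    set f := ξ (c u) with hf
    set g := ξ (c v) with hg
    obtain ⟨A, hA⟩ : ∃ A, A = ∑ i, f i • θ i := ⟨_, rfl⟩
    obtain ⟨B, hB⟩ : ∃ B, B = ∑ i, g i • θ i := ⟨_, rfl⟩
    have hA0 : ξ (c u - A) = 0 := by rw [map_sub, hA, htheta, sub_self]
    have hB0 : ξ (c v - B) = 0 := by rw [map_sub, hB, htheta, sub_self]
    have hT (f : ι → R) (v : L) : (X f : R →ₗ[K] R).rTensor L (c v) = -⁅∑ i, f i • θ i, c v⁆ := by
      rw [Derivation.rTensor_linearCombination]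
      simp only [hc, sum_lie, smul_lie, smul_neg, Finset.sum_neg_distrib]
    have hT0 (f : ι → R) (y : R ⊗[K] L) (hy : ξ y = 0) :
        ξ ((X f : R →ₗ[K] R).rTensor L y) = 0 := by
      rw [Derivation.rTensor_linearCombination]
      simp [hξD _ _ hy]
    have hTs (f g : ι → R) : (X f : R →ₗ[K] R).rTensor L (∑ i, g i • θ i) =
        ∑ i, X f (g i) • θ i + ∑ i, ∑ j, (f i * g j) • (D i : R →ₗ[K] R).rTensor L (θ j) := by
      simp only [map_sum, Derivation.rTensor_smul, Finset.sum_add_distrib,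
        Derivation.rTensor_linearCombination, hX, Finset.smul_sum, smul_smul]
      congr 1
      rw [Finset.sum_comm]
      simp only [mul_comm]
    have e₁ (f g : ι → R) (v : L) (h : ξ (c v - ∑ i, g i • θ i) = 0) :
        ξ ((X f : R →ₗ[K] R).rTensor L (c v)) = (fun j => X f (g j)) +
          ξ (∑ i, ∑ j, (f i * g j) • (D i : R →ₗ[K] R).rTensor L (θ j)) := by
      have := hT0 f _ h
      rw [map_sub, map_sub, sub_eq_zero, hTs, map_add, htheta] at this
      exact this
    have e₂ : ∑ i, ∑ j, (f i * g j) • (D i : R →ₗ[K] R).rTensor L (θ j) -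
        ∑ i, ∑ j, (g i * f j) • (D i : R →ₗ[K] R).rTensor L (θ j) = -⁅A, B⁆ := by
      rw [Finset.sum_comm (f := fun i j => (g i * f j) • (D i : R →ₗ[K] R).rTensor L (θ j)),
        hA, hB]
      simp only [← Finset.sum_sub_distrib, sum_lie, lie_sum, smul_lie, lie_smul, Finset.smul_sum,
        ← Finset.sum_neg_distrib]
      conv_rhs => rw [Finset.sum_comm]
      refine Finset.sum_congr rfl fun i _ => Finset.sum_congr rfl fun j _ => ?_
      rw [mul_comm (g _) (f _), ← smul_sub, hMC, smul_neg, smul_smul, mul_comm (g _)]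
    have e₃ := e₁ f g v (hB ▸ hB0)
    have e₄ := e₁ g f u (hA ▸ hA0)
    have e₅ : (fun j => X f (g j) - X g (f j)) =
        ξ ((X f : R →ₗ[K] R).rTensor L (c v)) - ξ ((X g : R →ₗ[K] R).rTensor L (c u)) + ξ ⁅A, B⁆ := by
      have : ξ ⁅A, B⁆ = -ξ (-⁅A, B⁆) := by rw [map_neg, neg_neg]
      rw [this, ← e₂, e₃, e₄, map_sub]
      ext j
      simp only [Pi.add_apply, Pi.sub_apply, Pi.neg_apply]
      ring
    rw [e₅, hT, hT, ← hA, ← hB, hclie, ← map_sub, ← map_add, ← map_neg, ← sub_eq_zero, ← map_sub]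
    have : -⁅A, c v⁆ - -⁅B, c u⁆ + ⁅A, B⁆ - -⁅c u, c v⁆ = ⁅c u - A, c v - B⁆ := by
      simp only [sub_lie, lie_sub]
      rw [← lie_skew B (c u)]
      abel
    rw [this]
    exact hξlie _ _ hA0 hB0
  -- By `hmain`, `v ↦ X (ξ (c v))` reverses brackets, as the vector fields of a left action do; the
  -- sign corrects this.
  let φ₀ : L →ₗ[K] Derivation K R R :=
    -((X.restrictScalars K).comp ((ξ.restrictScalars K).comp c))
  have hφ₀ (v : L) : φ₀ v = -X (ξ (c v)) := rfl
  let φ : L →ₗ⁅K⁆ Derivation K R R :=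
    { φ₀ with
      map_lie' := by
        intro u v
        change φ₀ ⁅u, v⁆ = ⁅φ₀ u, φ₀ v⁆
        rw [hφ₀, hφ₀, hφ₀, neg_lie, lie_neg, neg_neg, hX, Derivation.lie_linearCombination hcomm,
          ← hX, hmain, map_neg] }
  refine ⟨φ, (injective_iff_map_eq_zero φ₀).2 fun v hv => hinj v (hXinj ?_), ?_⟩
  · rw [map_zero, ← neg_eq_zero]
    exact hv
  · have : Submodule.span R (Set.range φ) = LinearMap.range X := by
      have h : Set.range φ = (-X) '' (Set.range fun v => ξ (c v)) := by
        rw [← Set.range_comp]; rfl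
      rw [h, Submodule.span_image, hspan, Submodule.map_top, LinearMap.range_neg]
    rw [this, ← Module.finrank_eq_rank, LinearMap.finrank_range_of_inj hXinj,
      Module.finrank_fintype_fun_eq_card]

end Frame

/-! ### Power series coefficients -/

section Series

/-- Formal power series in one variable over a commutative ring, as a commutative ring whose module
structures all come from the ring structure. -/
def Series (A : Type*) [CommRing A] : Type _ := PowerSeries A

namespace Series

variable {K A : Type*} [CommRing K] [CommRing A] [Algebra K A]

noncomputable instance : CommRing (Series A) := inferInstanceAs (CommRing (PowerSeries A))

instance [IsDomain A] : IsDomain (Series A) := inferInstanceAs (IsDomain (PowerSeries A))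

noncomputable instance : Algebra K (Series A) := inferInstanceAs (Algebra K (PowerSeries A))

instance {F : Type*} [CommRing F] [Algebra K F] [Algebra F A] [IsScalarTower K F A] :
    IsScalarTower K F (Series A) :=
  inferInstanceAs (IsScalarTower K F (PowerSeries A))

variable (A) in
/-- The `n`-th coefficient of a formal power series. -/
noncomputable def coeff (n : ℕ) : Series A →ₗ[A] A where
  toFun f := PowerSeries.coeff (R := A) n f
  map_add' f g := map_add (PowerSeries.coeff (R := A) n) f g
  map_smul' r f := map_smul (PowerSeries.coeff (R := A) n) r f

/-- The formal power series with given coefficients. -/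
def mk (f : ℕ → A) : Series A := PowerSeries.mk f

@[simp]
lemma coeff_mk (f : ℕ → A) (n : ℕ) : coeff A n (mk f) = f n := PowerSeries.coeff_mk (R := A) n f

@[ext]
lemma ext {f g : Series A} (h : ∀ n, coeff A n f = coeff A n g) : f = g :=
  PowerSeries.ext (R := A) h

lemma coeff_mul (n : ℕ) (f g : Series A) : coeff A n (f * g) =
    ∑ x ∈ Finset.HasAntidiagonal.antidiagonal n, coeff A x.1 f * coeff A x.2 g :=
  PowerSeries.coeff_mul (R := A) n f g

lemma coeff_algebraMap (n : ℕ) (a : A) :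
    coeff A n (algebraMap A (Series A) a) = if n = 0 then a else 0 :=
  PowerSeries.coeff_C (R := A) n a

variable (A) in
/-- The constant coefficient as a ring homomorphism. -/
noncomputable def constantCoeff : Series A →+* A := PowerSeries.constantCoeff (R := A)

lemma constantCoeff_apply (f : Series A) : constantCoeff A f = coeff A 0 f :=
  (PowerSeries.coeff_zero_eq_constantCoeff_apply (R := A) f).symm

variable (A) in
/-- The variable of the ring of formal power series. -/
noncomputable def X : Series A := PowerSeries.X (R := A)

lemma X_ne_zero [Nontrivial A] : X A ≠ 0 := PowerSeries.X_ne_zero (R := A)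

lemma exists_eq_X_mul {f : Series A} (hf : coeff A 0 f = 0) :
    ∃ g, f = X A * g ∧ coeff A 0 g = coeff A 1 f := by
  refine ⟨mk fun n => coeff A (n + 1) f, ext fun n => ?_, coeff_mk _ _⟩
  cases n with
  | zero => exact hf.trans (PowerSeries.coeff_zero_X_mul (R := A) _).symm
  | succ n => exact ((PowerSeries.coeff_succ_X_mul (R := A) n _).trans
      (coeff_mk (fun n => coeff A (n + 1) f) n)).symm

variable (A) in
/-- Differentiation of formal power series. -/
noncomputable def deriv : Derivation A (Series A) (Series A) :=
  Derivation.mk'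
    { toFun := fun f => PowerSeries.derivative A f
      map_add' := fun f g => map_add (PowerSeries.derivative A) f g
      map_smul' := fun r f => (PowerSeries.derivative A).map_smul r f }
    (fun f g => (PowerSeries.derivative A).leibniz f g)

lemma coeff_deriv (n : ℕ) (f : Series A) :
    coeff A n (deriv A f) = coeff A (n + 1) f * ((n + 1 : ℕ) : A) := by
  push_cast
  exact PowerSeries.coeff_derivative (R := A) f n

/-- Modulo the variable the matrix is the identity, so its determinant has constant coefficient `1`.
-/
lemma det_ne_zero {ι : Type*} [Fintype ι] [DecidableEq ι] [Nontrivial A]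
    {M : Matrix ι ι (Series A)} (hM : ∀ i j, coeff A 0 (M i j) = (1 : Matrix ι ι A) i j) :
    M.det ≠ 0 := by
  intro h
  have h₁ : (constantCoeff A).mapMatrix M = 1 := by
    ext i j
    simp [constantCoeff_apply, hM]
  have h₂ := (constantCoeff A).map_det M
  rw [h₁, h, map_zero, Matrix.det_one] at h₂
  exact zero_ne_one h₂

end Series

end Series

/-! ### Extending derivations to power series and to fraction fields -/

section Derivations

variable {K A : Type*} [CommRing K] [CommRing A] [Algebra K A]

/-- The derivation of `A⟦X⟧` applying a derivation of `A` to all coefficients. -/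
noncomputable def Derivation.mapSeries (D : Derivation K A A) :
    Derivation K (Series A) (Series A) :=
  Derivation.mk'
    { toFun := fun f => Series.mk fun n => D (Series.coeff A n f)
      map_add' := fun f g => by ext n; simp
      map_smul' := fun r f => by
        ext n
        simp [LinearMap.map_smul_of_tower] }
    (fun f g => by
      ext n
      simp only [LinearMap.coe_mk, AddHom.coe_mk, Series.coeff_mk, smul_eq_mul, map_add,
        Series.coeff_mul, map_sum, Derivation.leibniz, Finset.sum_add_distrib]
      congr 1
      exact Finset.Nat.sum_antidiagonal_swap (f := fun x =>
        Series.coeff A x.1 g * D (Series.coeff A x.2 f)))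

@[simp]
lemma Derivation.coeff_mapSeries (D : Derivation K A A) (f : Series A) (n : ℕ) :
    Series.coeff A n (D.mapSeries f) = D (Series.coeff A n f) :=
  Series.coeff_mk (fun n => D (Series.coeff A n f)) n

variable {R : Type*} [Field R] [Algebra K R] [Algebra A R] [IsScalarTower K A R]
  [IsFractionRing A R]

/-- A derivation is an algebra homomorphism `a ↦ a + ε D a` into the dual numbers over `R`. Nonzero
elements of `A` become units there, so the homomorphism extends to the fraction field, and its
`ε`-part is the extended derivation. -/
lemma Derivation.exists_extend_fractionRing [IsDomain A] (D : Derivation K A A) :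
    ∃ D' : Derivation K R R, ∀ a, D' (algebraMap A R a) = algebraMap A R (D a) := by
  let g : A →ₐ[K] TrivSqZeroExt R R :=
    { toFun := fun a => TrivSqZeroExt.inl (algebraMap A R a) +
        TrivSqZeroExt.inr (algebraMap A R (D a))
      map_one' := by ext <;> simp
      map_mul' := fun x y => by
        ext
        · simp
        · simp
          simp only [Algebra.smul_def]
          ring
      map_zero' := by ext <;> simp
      map_add' := fun x y => by
        ext
        · simp
        · simp
          simp only [Algebra.smul_def]
          ring
      commutes' := fun r => by
        ext <;> simp [← IsScalarTower.algebraMap_apply, TrivSqZeroExt.algebraMap_eq_inl'] }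
  have hg (y : nonZeroDivisors A) : IsUnit (g y) := by
    rw [TrivSqZeroExt.isUnit_iff_isUnit_fst]
    simp [g]
  let G : R →ₐ[K] TrivSqZeroExt R R := IsLocalization.liftAlgHom (M := nonZeroDivisors A) hg
  have hG (a : A) : G (algebraMap A R a) = g a := IsLocalization.lift_eq _ a
  have hfst : ((TrivSqZeroExt.fstHom K R R).comp G : R →ₐ[K] R) = AlgHom.id K R := by
    apply IsLocalization.algHom_ext (nonZeroDivisors A)
    ext a
    change (G (algebraMap A R a)).fst = algebraMap A R a
    simp [hG, g]
  have hfst' (r : R) : (G r).fst = r := DFunLike.congr_fun hfst r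
  refine ⟨Derivation.mk' ((TrivSqZeroExt.sndHom R R).restrictScalars K ∘ₗ G.toLinearMap)
    fun x y => ?_, fun a => ?_⟩
  · simp [hfst']
    ring
  · simp [hG, g]
    rw [Algebra.smul_def, mul_one]

end Derivations

lemma Derivation.ext_fractionRing {K A R : Type*} [CommRing K] [CommRing A] [IsDomain A]
    [Field R] [Algebra K R] [Algebra A R] [IsFractionRing A R] {D D' : Derivation K R R}
    (h : ∀ a, D (algebraMap A R a) = D' (algebraMap A R a)) : D = D' := by
  ext r
  obtain ⟨a, s, hs, rfl⟩ := IsFractionRing.div_surjective (A := A) r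
  have hs' : algebraMap A R s ≠ 0 := by
    simpa using nonZeroDivisors.ne_zero hs
  rw [Derivation.leibniz_div, Derivation.leibniz_div, h, h]

/-! ### Linear differential equations in `A⟦X⟧ ⊗ L` -/

section FormalODE

open scoped TensorProduct

variable {K A L : Type*} [Field K] [CommRing A] [Algebra K A] [LieRing L] [LieAlgebra K L]

/-- The `n`-th coefficient of an element of `A⟦X⟧ ⊗ L`. -/
noncomputable def tensorCoeff (K : Type*) {A : Type*} (L : Type*) [Field K] [CommRing A]
    [Algebra K A] [LieRing L] [LieAlgebra K L] (n : ℕ) : Series A ⊗[K] L →ₗ[K] A ⊗[K] L :=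
  ((Series.coeff A n).restrictScalars K).rTensor L

/-- Constants as elements of `A⟦X⟧ ⊗ L`. -/
noncomputable def tensorC (K : Type*) {A : Type*} (L : Type*) [Field K] [CommRing A]
    [Algebra K A] [LieRing L] [LieAlgebra K L] : A ⊗[K] L →ₗ[K] Series A ⊗[K] L :=
  (IsScalarTower.toAlgHom K A (Series A)).toLinearMap.rTensor L

@[simp]
lemma tensorCoeff_tmul (n : ℕ) (f : Series A) (v : L) :
    tensorCoeff K L n (f ⊗ₜ v) = Series.coeff A n f ⊗ₜ v := rfl

@[simp]
lemma tensorC_tmul (a : A) (v : L) : tensorC K L (a ⊗ₜ v) = algebraMap A _ a ⊗ₜ v := rfl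

lemma tensorCoeff_zero_tensorC (x : A ⊗[K] L) : tensorCoeff K L 0 (tensorC K L x) = x := by
  induction x with
  | zero => simp
  | add x y hx hy => simp only [map_add, hx, hy]
  | tmul a v => simp [Series.coeff_algebraMap]

lemma tensorCoeff_lie_tensorC (n : ℕ) (x : A ⊗[K] L) (y : Series A ⊗[K] L) :
    tensorCoeff K L n ⁅tensorC K L x, y⁆ = ⁅x, tensorCoeff K L n y⁆ := by
  induction x with
  | zero => simp
  | add x₁ x₂ h₁ h₂ => simp only [add_lie, map_add, h₁, h₂]
  | tmul a u =>
    induction y with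
    | zero => simp
    | add x₁ x₂ h₁ h₂ => simp only [lie_add, map_add, h₁, h₂]
    | tmul c v => simp [LieAlgebra.ExtendScalars.bracket_tmul, ← Algebra.smul_def]

lemma tensorCoeff_zero_lie (x y : Series A ⊗[K] L) :
    tensorCoeff K L 0 ⁅x, y⁆ = ⁅tensorCoeff K L 0 x, tensorCoeff K L 0 y⁆ := by
  induction x with
  | zero => simp
  | add x₁ x₂ h₁ h₂ => simp only [add_lie, map_add, h₁, h₂]
  | tmul a u =>
    induction y with
    | zero => simp
    | add x₁ x₂ h₁ h₂ => simp only [lie_add, map_add, h₁, h₂]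
    | tmul c v => simp [LieAlgebra.ExtendScalars.bracket_tmul, Series.coeff_mul]

lemma tensorCoeff_mapSeries (D : Derivation K A A) (n : ℕ) (y : Series A ⊗[K] L) :
    tensorCoeff K L n
      ((D.mapSeries : Series A →ₗ[K] Series A).rTensor L y) =
      (D : A →ₗ[K] A).rTensor L (tensorCoeff K L n y) := by
  induction y with
  | zero => simp
  | add x₁ x₂ h₁ h₂ => simp only [map_add, h₁, h₂]
  | tmul c v => simp

lemma rTensor_mapSeries_tensorC (D : Derivation K A A) (x : A ⊗[K] L) :
    (D.mapSeries : Series A →ₗ[K] Series A).rTensor L (tensorC K L x) =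
      tensorC K L ((D : A →ₗ[K] A).rTensor L x) := by
  induction x with
  | zero => simp
  | add x₁ x₂ h₁ h₂ => simp only [map_add, h₁, h₂]
  | tmul c v =>
    simp only [tensorC_tmul, LinearMap.rTensor_tmul]
    congr 1
    ext n
    simp [Series.coeff_algebraMap, apply_ite D]

variable (K A L) in
/-- Differentiation with respect to the variable in `A⟦X⟧ ⊗ L`. -/
noncomputable def tensorDeriv : Series A ⊗[K] L →ₗ[K] Series A ⊗[K] L :=
  (((Series.deriv A).restrictScalars K : Derivation K (Series A) (Series A)) :
    Series A →ₗ[K] Series A).rTensor L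

lemma tensorDeriv_lie (x y : Series A ⊗[K] L) :
    tensorDeriv K A L ⁅x, y⁆ = ⁅tensorDeriv K A L x, y⁆ + ⁅x, tensorDeriv K A L y⁆ :=
  Derivation.rTensor_lie _ x y

lemma tensorCoeff_tensorDeriv (n : ℕ) (y : Series A ⊗[K] L) :
    tensorCoeff K L n (tensorDeriv K A L y) = ((n + 1 : ℕ) : K) • tensorCoeff K L (n + 1) y := by
  induction y with
  | zero => simp
  | add x₁ x₂ h₁ h₂ => simp only [map_add, h₁, h₂, smul_add]
  | tmul c v =>
    simp only [tensorDeriv, LinearMap.rTensor_tmul, tensorCoeff_tmul, TensorProduct.smul_tmul']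
    congr 1
    simp [Series.coeff_deriv, Algebra.smul_def, mul_comm]

/-- For finite-dimensional `L`, elements of `A⟦X⟧ ⊗ L` correspond to arbitrary sequences in `A ⊗ L`;
this is the uniqueness half, and `exists_tensorCoeff_eq` is the existence half. -/
lemma tensor_ext [FiniteDimensional K L] {y z : Series A ⊗[K] L}
    (h : ∀ n, tensorCoeff K L n y = tensorCoeff K L n z) : y = z := by
  let b := Module.finBasis K L
  have hrepr (n : ℕ) (y : Series A ⊗[K] L) (j) : (b.baseChange A).repr (tensorCoeff K L n y) j
      = Series.coeff A n ((b.baseChange (Series A)).repr y j) := by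
    induction y with
    | zero => simp
    | add x₁ x₂ h₁ h₂ => simp only [map_add, Finsupp.add_apply, h₁, h₂]
    | tmul c v => simp [Basis.baseChange_repr_tmul]
  apply (b.baseChange (Series A)).repr.injective
  ext j n
  rw [← hrepr, ← hrepr, h]

lemma exists_tensorCoeff_eq [FiniteDimensional K L] (z : ℕ → A ⊗[K] L) :
    ∃ y : Series A ⊗[K] L, ∀ n, tensorCoeff K L n y = z n := by
  let b := Module.finBasis K L
  refine ⟨∑ j, (Series.mk fun n => (b.baseChange A).repr (z n) j) ⊗ₜ b j, fun n => ?_⟩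
  conv_rhs => rw [← (b.baseChange A).sum_repr (z n)]
  simp [TensorProduct.smul_tmul']

/-- Uniqueness for the formal differential equation `y' = -[x, y]`. -/
lemma eq_zero_of_tensorDeriv_eq [CharZero K] [FiniteDimensional K L] {x : A ⊗[K] L}
    {y : Series A ⊗[K] L} (h0 : tensorCoeff K L 0 y = 0)
    (h : tensorDeriv K A L y = -⁅tensorC K L x, y⁆) : y = 0 := by
  refine tensor_ext fun n => ?_
  rw [map_zero]
  induction n with
  | zero => exact h0
  | succ n ih =>
    have := congrArg (tensorCoeff K L n) h
    rw [tensorCoeff_tensorDeriv, map_neg, tensorCoeff_lie_tensorC, ih, lie_zero, neg_zero,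
      smul_eq_zero] at this
    exact this.resolve_left (Nat.cast_ne_zero.2 n.succ_ne_zero)

/-- Existence for the formal differential equation `y' = f - [x, y]`. -/
lemma exists_tensorDeriv_eq [CharZero K] [FiniteDimensional K L] (x z : A ⊗[K] L)
    (f : Series A ⊗[K] L) : ∃ y : Series A ⊗[K] L, tensorCoeff K L 0 y = z ∧
      tensorDeriv K A L y = f - ⁅tensorC K L x, y⁆ := by
  -- Comparing coefficients forces `(n + 1) y_{n+1} = f_n - ⁅x, y_n⁆`; characteristic zero allows
  -- the division.
  let s : ℕ → A ⊗[K] L := fun n => Nat.rec z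
    (fun n y => ((n + 1 : ℕ) : K)⁻¹ • (tensorCoeff K L n f - ⁅x, y⁆)) n
  obtain ⟨y, hy⟩ := exists_tensorCoeff_eq (K := K) (L := L) s
  refine ⟨y, hy 0, tensor_ext fun n => ?_⟩
  rw [tensorCoeff_tensorDeriv, map_sub, tensorCoeff_lie_tensorC, hy, hy]
  exact smul_inv_smul₀ (Nat.cast_ne_zero.2 n.succ_ne_zero) _

end FormalODE

/-! ### The formal homogeneous space and its field of functions -/

section Realization

open scoped TensorProduct

/-- The moving frame `θ` and the adjoint transport `c` of the chart
`x ↦ exp (t • ∑ i, x i • e i)`. -/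
lemma exists_formal_frame {K A L ι : Type*} [Field K] [CharZero K] [CommRing A] [Algebra K A]
    [LieRing L] [LieAlgebra K L] [FiniteDimensional K L] [Fintype ι] [DecidableEq ι]
    {D : ι → Derivation K A A} {x : ι → A} (hx : ∀ i j, D i (x j) = if i = j then 1 else 0)
    (e : ι → L) :
    ∃ (θ : ι → Series A ⊗[K] L) (c : L →ₗ[K] Series A ⊗[K] L),
      (∀ i, tensorCoeff K L 0 (θ i) = 0) ∧ (∀ i, tensorCoeff K L 1 (θ i) = 1 ⊗ₜ e i) ∧
      (∀ v, tensorCoeff K L 0 (c v) = 1 ⊗ₜ v) ∧ (∀ u v, c ⁅u, v⁆ = ⁅c u, c v⁆) ∧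
      (∀ i v, ((D i).mapSeries : Series A →ₗ[K] Series A).rTensor L (c v) = -⁅θ i, c v⁆) ∧
      (∀ i j, ((D i).mapSeries : Series A →ₗ[K] Series A).rTensor L (θ j) -
        ((D j).mapSeries : Series A →ₗ[K] Series A).rTensor L (θ i) = -⁅θ i, θ j⁆) := by
  obtain ⟨z, hz⟩ : ∃ z : A ⊗[K] L, z = ∑ i, x i ⊗ₜ e i := ⟨_, rfl⟩
  have hDz (i : ι) : (D i : A →ₗ[K] A).rTensor L z = 1 ⊗ₜ e i := by
    simp [hz, hx, TensorProduct.ite_tmul]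
  -- For `g = exp (t z)`, differentiation in `t` of `θ i = g⁻¹ ∂ᵢ g` gives `θ' = e i - ⁅z, θ⁆` with
  -- `θ(0) = 0`, and that of `c v = Ad(g⁻¹) v` gives `c' = -⁅z, c⁆` with `c(0) = v`. These equations
  -- serve as definitions.
  choose θ hθ0 hθ using fun i => exists_tensorDeriv_eq (K := K) (L := L) z 0
    (tensorC K L (1 ⊗ₜ e i))
  choose c₀ hc₀0 hc₀ using fun v => exists_tensorDeriv_eq (K := K) (L := L) z (1 ⊗ₜ v) 0
  let c : L →ₗ[K] Series A ⊗[K] L :=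
    { toFun := c₀
      map_add' := fun u v => by
        rw [← sub_eq_zero]
        apply eq_zero_of_tensorDeriv_eq (x := z)
        · simp [hc₀0, TensorProduct.tmul_add]
        · simp only [map_sub, map_add, hc₀, lie_sub, lie_add]
          abel
      map_smul' := fun r v => by
        rw [← sub_eq_zero]
        apply eq_zero_of_tensorDeriv_eq (x := z)
        · simp [hc₀0]
        · simp only [map_sub, map_smul, hc₀, lie_sub, RingHom.id_apply, lie_smul]
          module }
  have hc0 (v : L) : tensorCoeff K L 0 (c v) = 1 ⊗ₜ v := hc₀0 v
  have hc (v : L) : tensorDeriv K A L (c v) = -⁅tensorC K L z, c v⁆ := (hc₀ v).trans (zero_sub _)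
  have hcomm (i : ι) (y : Series A ⊗[K] L) : tensorDeriv K A L
      (((D i).mapSeries : Series A →ₗ[K] Series A).rTensor L y) =
      ((D i).mapSeries : Series A →ₗ[K] Series A).rTensor L (tensorDeriv K A L y) :=
    tensor_ext fun n => by
      simp only [tensorCoeff_tensorDeriv, tensorCoeff_mapSeries, map_smul]
  have hlie0 (a b : Series A ⊗[K] L) (ha : tensorCoeff K L 0 a = 0) :
      tensorCoeff K L 0 ⁅a, b⁆ = 0 := by
    rw [tensorCoeff_zero_lie, ha, zero_lie]
  -- Apart from the first coefficient of `θ`, each identity holds because the difference of its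
  -- sides solves `y' = -⁅z, y⁆` with zero initial value, by the Jacobi identity.
  refine ⟨θ, c, hθ0, fun i => ?_, hc0, fun u v => ?_, fun i v => ?_, fun i j => ?_⟩
  · have := congrArg (tensorCoeff K L 0) (hθ i)
    rw [tensorCoeff_tensorDeriv, map_sub, tensorCoeff_lie_tensorC, hθ0, lie_zero, sub_zero,
      tensorCoeff_zero_tensorC] at this
    simpa using this
  · rw [← sub_eq_zero]
    apply eq_zero_of_tensorDeriv_eq (x := z)
    · simp [tensorCoeff_zero_lie, hc0, LieAlgebra.ExtendScalars.bracket_tmul]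
    · rw [map_sub, tensorDeriv_lie, hc, hc, hc, lie_sub, leibniz_lie (tensorC K L z), neg_lie,
        lie_neg]
      abel
  · rw [← sub_eq_zero, sub_neg_eq_add]
    apply eq_zero_of_tensorDeriv_eq (x := z)
    · simp [tensorCoeff_mapSeries, hc0, hlie0 _ _ (hθ0 i)]
    · rw [map_add, tensorDeriv_lie, hcomm, hc, hθ, map_neg, Derivation.rTensor_lie,
        rTensor_mapSeries_tensorC, hDz, sub_lie, lie_neg, lie_add, leibniz_lie (tensorC K L z)]
      abel
  · rw [← sub_eq_zero, sub_neg_eq_add]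
    apply eq_zero_of_tensorDeriv_eq (x := z)
    · simp [tensorCoeff_mapSeries, hθ0, hlie0 _ _ (hθ0 i)]
    · rw [map_add, map_sub, tensorDeriv_lie, hcomm, hcomm, hθ, hθ, map_sub, map_sub,
        Derivation.rTensor_lie, Derivation.rTensor_lie]
      simp only [rTensor_mapSeries_tensorC, hDz, LinearMap.rTensor_tmul, Derivation.coeFn_coe,
        Derivation.map_one_eq_zero, TensorProduct.zero_tmul, map_zero, sub_lie, lie_sub, lie_add,
        leibniz_lie (tensorC K L z) (θ i)]
      rw [← lie_skew (θ i) (tensorC K L (1 ⊗ₜ e j))]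
      abel

lemma Derivation.mapSeries_algebraMap {K A : Type*} [CommRing K] [CommRing A] [Algebra K A]
    (D : Derivation K A A) (a : A) :
    D.mapSeries (algebraMap A (Series A) a) = algebraMap A (Series A) (D a) := by
  ext1 n
  rw [Derivation.coeff_mapSeries, Series.coeff_algebraMap, Series.coeff_algebraMap, apply_ite D,
    map_zero]

lemma exists_extend_fractionRing_series {F A R ι : Type*} [CommRing F] [CommRing A] [IsDomain A]
    [Algebra F A] [Field R] [Algebra F R] [Algebra (Series A) R] [IsScalarTower F (Series A) R]
    [IsFractionRing (Series A) R] {D : ι → Derivation F A A} (hD : ∀ i j, ⁅D i, D j⁆ = 0) :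
    ∃ D' : ι → Derivation F R R, (∀ i s, D' i (algebraMap (Series A) R s) =
      algebraMap (Series A) R ((D i).mapSeries s)) ∧ ∀ i j, ⁅D' i, D' j⁆ = 0 := by
  choose D' hD' using fun i => ((D i).mapSeries).exists_extend_fractionRing (R := R)
  refine ⟨D', hD', fun i j => Derivation.ext_fractionRing (A := Series A) fun s => ?_⟩
  have hcomm (a : A) : D i (D j a) = D j (D i a) := by
    have := DFunLike.congr_fun (hD i j) a
    rwa [Derivation.commutator_apply, Derivation.zero_apply, sub_eq_zero] at this
  rw [Derivation.commutator_apply, Derivation.zero_apply, sub_eq_zero, hD', hD', hD', hD']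
  congr 1
  ext1 n
  simp [hcomm]

/-- A finite-dimensional Lie algebra `L` in characteristic zero whose scalar extension `F ⊗ L` has
a subalgebra of codimension `k`, meeting `L` in zero, is realized by derivations of a field whose
span has dimension `k`. The subalgebra is the kernel of the `F`-linear extension of `p`. -/
theorem hasFieldRealization_of_extendPi {K : Type u} {L : Type v} {F : Type u} {ι : Type w}
    [Field K] [CharZero K] [LieRing L] [LieAlgebra K L] [FiniteDimensional K L] [Field F]
    [Algebra K F] [Fintype ι] [DecidableEq ι] {p : L →ₗ[K] (ι → F)} {e : ι → L}
    (he : ∀ i, p (e i) = Pi.single i 1)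
    (hp : ∀ x y : F ⊗[K] L, extendPi p F x = 0 → extendPi p F y = 0 → extendPi p F ⁅x, y⁆ = 0)
    (hinj : ∀ v, p v = 0 → v = 0) :
    HasFieldRealization.{u, v, w} K L (Fintype.card ι) := by
  let A := MvPolynomial ι F
  let S := Series A
  let R := FractionRing S
  -- The partial derivatives are `F`-linear, hence their extensions preserve the scalar extension of
  -- the subalgebra, which is defined over `F`.
  let DF (i : ι) : Derivation F A A := MvPolynomial.pderiv i
  let DA (i : ι) : Derivation K A A := (DF i).restrictScalars K
  have hx (i j : ι) : DA i (MvPolynomial.X j) = if i = j then 1 else 0 := by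
    change MvPolynomial.pderiv i (MvPolynomial.X j) = _
    rw [MvPolynomial.pderiv_X, Pi.single_apply]
    simp only [eq_comm]
  obtain ⟨θ, c, hθ0, hθ1, hc0, hclie, hc, hMC⟩ := exists_formal_frame hx e
  have hDFcomm (i j : ι) : ⁅DF i, DF j⁆ = 0 := MvPolynomial.derivation_ext fun l => by
    simp [DF, Derivation.commutator_apply, MvPolynomial.pderiv_X, Pi.single_apply, apply_ite]
  obtain ⟨DR, hDR, hDRcomm⟩ := exists_extend_fractionRing_series (R := R) hDFcomm
  let J : S ⊗[K] L →ₗ[K] R ⊗[K] L := (IsScalarTower.toAlgHom K S R).toLinearMap.rTensor L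
  have hJlie (y z : S ⊗[K] L) : J ⁅y, z⁆ = ⁅J y, J z⁆ := AlgHom.rTensor_lie _ y z
  have hJD (i : ι) (y : S ⊗[K] L) :
      (((DR i).restrictScalars K : Derivation K R R) : R →ₗ[K] R).rTensor L (J y) =
        J (((DA i).mapSeries : S →ₗ[K] S).rTensor L y) := by
    induction y with
    | zero => simp
    | add y z hy hz => simp only [map_add, hy, hz]
    | tmul s v => exact congrArg (· ⊗ₜ[K] v) (hDR i s)
  have hπJ (y : S ⊗[K] L) (j : ι) :
      extendPi p R (J y) j = algebraMap S R (extendPi p S y j) :=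
    extendPi_rTensor p (IsScalarTower.toAlgHom F S R).toLinearMap y j
  have hπc (n : ℕ) (y : S ⊗[K] L) (j : ι) :
      Series.coeff A n (extendPi p S y j) = extendPi p A (tensorCoeff K L n y) j :=
    (extendPi_rTensor p ((Series.coeff A n).restrictScalars F) y j).symm
  have hSR : Function.Injective (algebraMap S R) := IsFractionRing.injective S R
  have hdetR {M : Matrix ι ι S} (hM : M.det ≠ 0) : IsUnit ((algebraMap S R).mapMatrix M).det := by
    rw [← RingHom.map_det, isUnit_iff_ne_zero]
    exact (map_ne_zero_iff _ hSR).2 hM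
  let Θ : Matrix ι ι S := Matrix.of fun i j => extendPi p S (θ i) j
  -- Since `θ i = t e i + O(t²)`, the matrix is `t` times one congruent to the identity modulo `t`.
  have hΘ : Θ.det ≠ 0 := by
    choose Θ' hΘ' hΘ'0 using fun i j => Series.exists_eq_X_mul (f := Θ i j)
      (by simp [Θ, hπc, hθ0])
    have h : Θ = Series.X A • Matrix.of Θ' := by
      ext1 i j
      exact hΘ' i j
    rw [h, Matrix.det_smul]
    refine mul_ne_zero (pow_ne_zero _ Series.X_ne_zero) (Series.det_ne_zero fun i j => ?_)
    rw [Matrix.of_apply, hΘ'0]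
    simp [Θ, hπc, hθ1, he, Matrix.one_apply, Pi.single_apply, eq_comm]
  let ΘR : Matrix ι ι R := (algebraMap S R).mapMatrix Θ
  have hΘR : IsUnit ΘR.det := hdetR hΘ
  let M : Matrix ι ι S := Matrix.of fun i j => extendPi p S (c (e i)) j
  have hM : M.det ≠ 0 := Series.det_ne_zero fun i j => by
    simp [M, hπc, hc0, he, Matrix.one_apply, Pi.single_apply, eq_comm]
  let MR : Matrix ι ι R := (algebraMap S R).mapMatrix M
  have hMR : IsUnit MR.det := hdetR hM
  -- The change of basis by `ΘR⁻¹` keeps the kernel and makes the `θ i` dual to the coordinates.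
  let ξ : R ⊗[K] L →ₗ[R] (ι → R) := (Matrix.vecMulLinear ΘR⁻¹).comp (extendPi p R)
  have hξ (y : R ⊗[K] L) : ξ y = Matrix.vecMul (extendPi p R y) ΘR⁻¹ := rfl
  have hξ0 (y : R ⊗[K] L) : ξ y = 0 ↔ extendPi p R y = 0 := by
    refine ⟨fun h => ?_, fun h => by rw [hξ, h, Matrix.zero_vecMul]⟩
    have := congrArg (Matrix.vecMul · ΘR) h
    simp only [hξ] at this
    rwa [Matrix.vecMul_vecMul, Matrix.nonsing_inv_mul _ hΘR, Matrix.vecMul_one,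
      Matrix.zero_vecMul] at this
  obtain ⟨φ, hφ, hrank⟩ := exists_realization_of_frame (K := K) (L := L) (R := R) (ι := ι)
    (D := fun i => (DR i).restrictScalars K)
    (x := fun i => algebraMap S R (algebraMap A S (MvPolynomial.X i)))
    (ξ := ξ) (θ := fun i => J (θ i)) (c := J.comp c)
    (fun i j => by
      ext r
      exact DFunLike.congr_fun (hDRcomm i j) r)
    (fun i j => by
      change DR i _ = _
      rw [hDR, Derivation.mapSeries_algebraMap]
      change algebraMap S R (algebraMap A S (DA i (MvPolynomial.X j))) = _
      rw [hx]
      split_ifs <;> simp)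
    (fun y z hy hz => by
      rw [hξ0] at hy hz ⊢
      exact extendPi_lie_eq_zero p he hp hy hz)
    (fun i y hy => by
      rw [hξ0] at hy ⊢
      ext j
      have := extendPi_rTensor p (DR i : R →ₗ[F] R) y j
      rw [hy, Pi.zero_apply, map_zero] at this
      exact this)
    (fun i => by
      have : extendPi p R (J (θ i)) = ΘR i := funext fun j => hπJ _ _
      rw [hξ, this]
      change (ΘR * ΘR⁻¹) i = _
      rw [Matrix.mul_nonsing_inv _ hΘR]
      ext j
      simp [Matrix.one_apply, Pi.single_apply, eq_comm])
    (fun u v => by simp only [LinearMap.comp_apply, hclie, hJlie])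
    (fun i v => by
      simp only [LinearMap.comp_apply]
      rw [hJD, hc, map_neg, hJlie])
    (fun i j => by
      rw [hJD, hJD, ← map_sub, hMC, map_neg, hJlie])
    (by
      rw [eq_top_iff]
      intro f _
      have hrow (i : ι) : extendPi p R (J (c (e i))) = MR i := funext fun j => hπJ _ _
      have h : f = ∑ i, Matrix.vecMul f (ΘR * MR⁻¹) i • ξ (J (c (e i))) := by
        simp_rw [hξ, hrow]
        change f = ∑ i, Matrix.vecMul f (ΘR * MR⁻¹) i • (MR * ΘR⁻¹) i
        rw [← Matrix.vecMul_eq_sum, Matrix.vecMul_vecMul, Matrix.mul_assoc,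
          Matrix.nonsing_inv_mul_cancel_left _ _ hMR, Matrix.mul_nonsing_inv _ hΘR,
          Matrix.vecMul_one]
      rw [h]
      exact Submodule.sum_mem _ fun i _ => Submodule.smul_mem _ _
        (Submodule.subset_span ⟨e i, rfl⟩))
    (fun v hv => by
      rw [hξ0] at hv
      refine hinj v (funext fun j => ?_)
      have h₁ := congrFun hv j
      rw [LinearMap.comp_apply, hπJ, Pi.zero_apply, map_eq_zero_iff _ hSR] at h₁
      have h₂ := hπc 0 (c v) j
      rw [h₁, map_zero, hc0, extendPi_tmul, one_mul, eq_comm, map_eq_zero] at h₂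
      exact h₂)
  exact ⟨R, inferInstance, inferInstance, φ, hφ, hrank⟩

end Realization

/-! ### Row spaces of matrices and polynomial tests for membership -/

section RowSpan

variable {K : Type*} {L : Type*} [Field K] [LieRing L] [LieAlgebra K L] {m d : ℕ}

/-- The matrix with the given entries. -/
def entriesMatrix {K : Type*} {m d : ℕ} (a : Fin d × Fin m → K) : Matrix (Fin d) (Fin m) K :=
  Matrix.of fun i j => a (i, j)

lemma rowVec_eq (b : Basis (Fin m) K L) (a : Fin d × Fin m → K) (i : Fin d) :
    rowVec b a i = b.equivFun.symm (entriesMatrix a i) := by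
  simp [rowVec, entriesMatrix, Basis.equivFun_symm_apply]

lemma mem_rowSpan_iff (b : Basis (Fin m) K L) (a : Fin d × Fin m → K) (q : Fin m → K) :
    ∑ j, q j • b j ∈ rowSpan b a ↔ ∃ c, Matrix.vecMul c (entriesMatrix a) = q := by
  rw [rowSpan, Submodule.mem_span_range_iff_exists_fun, ← Basis.equivFun_symm_apply]
  simp_rw [rowVec_eq, ← map_smul, ← map_sum, b.equivFun.symm.injective.eq_iff,
    Matrix.vecMul_eq_sum]

/-- The right inverse `N` is the form in which full rank is carried between special and generic
points. -/
lemma linearIndependent_rowVec_iff (b : Basis (Fin m) K L) (a : Fin d × Fin m → K) :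
    LinearIndependent K (rowVec b a) ↔
      ∃ N : Matrix (Fin m) (Fin d) K, entriesMatrix a * N = 1 := by
  have h : rowVec b a = b.equivFun.symm.toLinearMap ∘ (entriesMatrix a).row :=
    funext fun i => rowVec_eq b a i
  rw [h, LinearMap.linearIndependent_iff _ b.equivFun.symm.ker, ← Matrix.vecMul_injective_iff]
  constructor
  · intro hinj
    obtain ⟨g, hg⟩ := LinearMap.exists_leftInverse_of_injective (entriesMatrix a).vecMulLinear
      (LinearMap.ker_eq_bot.2 hinj)
    refine ⟨LinearMap.toMatrixRight' g, ?_⟩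
    have h : entriesMatrix a = LinearMap.toMatrixRight' (entriesMatrix a).vecMulLinear :=
      (LinearMap.toMatrixRight'.apply_symm_apply _).symm
    rw [h, ← LinearMap.toMatrixRight'_comp, hg, LinearMap.toMatrixRight'_id]
  · rintro ⟨N, hN⟩ x y hxy
    have := congrArg (Matrix.vecMul · N) hxy
    simpa only [Matrix.vecMul_vecMul, hN, Matrix.vecMul_one] using this

lemma linearIndependent_rowVec_of_det_ne_zero (b : Basis (Fin m) K L) {a : Fin d × Fin m → K}
    {N : Matrix (Fin m) (Fin d) K} (h : (entriesMatrix a * N).det ≠ 0) :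
    LinearIndependent K (rowVec b a) := by
  rw [linearIndependent_rowVec_iff]
  exact ⟨N * (entriesMatrix a * N)⁻¹, by
    rw [← Matrix.mul_assoc, Matrix.mul_nonsing_inv _ (isUnit_iff_ne_zero.2 h)]⟩

/-- The obstruction for the coordinate vector `q` to lie in the row space of `a`, relative to
an auxiliary matrix `N`. -/
def rowDefect {R : Type*} [CommRing R] (a : Matrix (Fin d) (Fin m) R) (N : Matrix (Fin m) (Fin d) R)
    (q : Fin m → R) : Fin m → R :=
  (a * N).det • q - Matrix.vecMul q (N * (a * N).adjugate * a)

/-- The adjugate, in place of an inverse, keeps the defect polynomial in all entries. It can thus be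
formed for the matrix of variables and then specialized. -/
lemma map_rowDefect {R S : Type*} [CommRing R] [CommRing S] (f : R →+* S)
    (a : Matrix (Fin d) (Fin m) R) (N : Matrix (Fin m) (Fin d) R) (q : Fin m → R) :
    f ∘ rowDefect a N q = rowDefect (a.map f) (N.map f) (f ∘ q) := by
  have h := RingHom.map_vecMul f (N * (a * N).adjugate * a) q
  ext j
  have hadj := RingHom.map_adjugate f (a * N)
  have hdet := RingHom.map_det f (a * N)
  simp only [RingHom.mapMatrix_apply, Matrix.map_mul] at hadj hdet
  simp [rowDefect, h, Matrix.map_mul, hadj, hdet]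

lemma rowDefect_eq_zero_of_mem {R : Type*} [CommRing R] (a : Matrix (Fin d) (Fin m) R)
    (N : Matrix (Fin m) (Fin d) R) (c : Fin d → R) : rowDefect a N (Matrix.vecMul c a) = 0 := by
  rw [rowDefect, Matrix.vecMul_vecMul, ← Matrix.mul_assoc, ← Matrix.mul_assoc,
    Matrix.mul_adjugate, Matrix.smul_mul, Matrix.one_mul, Matrix.vecMul_smul, sub_self]

lemma exists_vecMul_eq_of_rowDefect_eq_zero {a : Matrix (Fin d) (Fin m) K}
    {N : Matrix (Fin m) (Fin d) K} (h : (a * N).det ≠ 0) {q : Fin m → K}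
    (hq : rowDefect a N q = 0) : ∃ c, Matrix.vecMul c a = q := by
  rw [rowDefect, sub_eq_zero, ← Matrix.vecMul_vecMul] at hq
  refine ⟨(a * N).det⁻¹ • Matrix.vecMul q (N * (a * N).adjugate), ?_⟩
  rw [Matrix.smul_vecMul, ← hq, inv_smul_smul₀ h]

lemma exists_lieSubalgebra_eq_rowSpan_iff (b : Basis (Fin m) K L) (a : Fin d × Fin m → K) :
    (∃ H : LieSubalgebra K L, H.toSubmodule = rowSpan b a) ↔
      ∀ i j, ⁅rowVec b a i, rowVec b a j⁆ ∈ rowSpan b a := by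
  constructor
  · rintro ⟨H, hH⟩ i j
    have h (i : Fin d) : rowVec b a i ∈ H.toSubmodule := hH ▸ Submodule.subset_span ⟨i, rfl⟩
    exact hH ▸ H.lie_mem (h i) (h j)
  · intro h
    refine ⟨{ rowSpan b a with lie_mem' := fun {x y} hx hy => ?_ }, rfl⟩
    refine Submodule.span_induction₂ (p := fun x y _ _ => ⁅x, y⁆ ∈ rowSpan b a) ?_ ?_ ?_ ?_ ?_ ?_ ?_
      hx hy
    · rintro _ _ ⟨i, rfl⟩ ⟨j, rfl⟩
      exact h i j
    · intro y _; simp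
    · intro x _; simp
    · intro x y z _ _ _ h₁ h₂
      rw [add_lie]; exact add_mem h₁ h₂
    · intro x y z _ _ _ h₁ h₂
      rw [lie_add]; exact add_mem h₁ h₂
    · intro r x y _ _ h₁
      rw [smul_lie]; exact Submodule.smul_mem _ _ h₁
    · intro r x y _ _ h₁
      rw [lie_smul]; exact Submodule.smul_mem _ _ h₁

end RowSpan

/-! ### Irreducible varieties and prime ideals -/

section Varieties

variable {σ K : Type*} [Field K]

lemma isClosed_zariskiTop_iff {Z : Set (σ → K)} : @IsClosed (σ → K) (zariskiTop σ K) Z ↔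
    ∃ I : Ideal (MvPolynomial σ K), Z = MvPolynomial.zeroLocus K I := by
  let _ := zariskiTop σ K
  rw [← isOpen_compl_iff]
  change (Zᶜᶜ ∈ {Z | ∃ I : Ideal (MvPolynomial σ K), Z = MvPolynomial.zeroLocus K I}) ↔ _
  rw [compl_compl]
  rfl

lemma isClosed_zariskiTop_zeroLocus (I : Ideal (MvPolynomial σ K)) :
    @IsClosed (σ → K) (zariskiTop σ K) (MvPolynomial.zeroLocus K I) :=
  isClosed_zariskiTop_iff.2 ⟨I, rfl⟩

lemma IsIrreducibleVariety.isPrime_vanishingIdeal {V : Set (σ → K)} (hV : IsIrreducibleVariety V) :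
    (MvPolynomial.vanishingIdeal K V).IsPrime := by
  let _ := zariskiTop σ K
  obtain ⟨-, ⟨x, hx⟩, hirr⟩ := hV
  refine ⟨fun h => ?_, fun {f g} hfg => ?_⟩
  · have : (1 : MvPolynomial σ K) ∈ MvPolynomial.vanishingIdeal K V := h ▸ Submodule.mem_top
    simpa using this x hx
  · have hmem (f : MvPolynomial σ K) (h : V ⊆ MvPolynomial.zeroLocus K (Ideal.span {f})) :
        f ∈ MvPolynomial.vanishingIdeal K V :=
      fun x hx => h hx f (Ideal.mem_span_singleton_self f)
    refine (isPreirreducible_iff_isClosed_union_isClosed.1 hirr _ _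
      (isClosed_zariskiTop_zeroLocus (Ideal.span {f}))
      (isClosed_zariskiTop_zeroLocus (Ideal.span {g})) fun x hx => ?_).imp (hmem f) (hmem g)
    have := hfg x hx
    rw [map_mul, mul_eq_zero] at this
    simpa [MvPolynomial.zeroLocus_span] using this

/-- By the Nullstellensatz `P` is the full vanishing ideal of its zero locus, so a covering by two
closed sets gives a product of ideals inside the prime `P`. -/
lemma isIrreducibleVariety_zeroLocus [Finite σ] [IsAlgClosed K] (P : Ideal (MvPolynomial σ K))
    [hP : P.IsPrime] : IsIrreducibleVariety (MvPolynomial.zeroLocus K P) := by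
  let _ := zariskiTop σ K
  have hvan := MvPolynomial.IsPrime.vanishingIdeal_zeroLocus (K := K) P
  refine ⟨isClosed_zariskiTop_zeroLocus P, ?_, ?_⟩
  · rw [Set.nonempty_iff_ne_empty]
    intro h
    rw [h, MvPolynomial.vanishingIdeal_empty] at hvan
    exact hP.ne_top hvan.symm
  · rw [isPreirreducible_iff_isClosed_union_isClosed]
    intro Z₁ Z₂ h₁ h₂ h
    rw [isClosed_zariskiTop_iff] at h₁ h₂
    obtain ⟨I, rfl⟩ := h₁
    obtain ⟨J, rfl⟩ := h₂
    have hIJ : I * J ≤ P := by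
      rw [← hvan, Ideal.mul_le]
      intro f hf g hg x hx
      rw [map_mul, mul_eq_zero]
      exact (h hx).imp (fun h => h f hf) (fun h => h g hg)
    exact (hP.mul_le.1 hIJ).imp (MvPolynomial.zeroLocus_anti_mono ·)
      (MvPolynomial.zeroLocus_anti_mono ·)

end Varieties

/-! ### Transfer between a variety and its generic point -/

section GenericPoint

variable {K F L M : Type*} [Field K] [Field F] [Algebra K F] [LieRing L] [LieAlgebra K L]
  [LieRing M] [LieAlgebra F M] {m d : ℕ}

/-- The matrix of variables. -/
noncomputable def genericMatrix (K : Type*) [Field K] (d m : ℕ) :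
    Matrix (Fin d) (Fin m) (MvPolynomial (Fin d × Fin m) K) :=
  Matrix.of fun i j => MvPolynomial.X (i, j)

lemma genericMatrix_map_aeval (A : Fin d × Fin m → F) :
    (genericMatrix K d m).map (MvPolynomial.aeval (R := K) A) = entriesMatrix A := by
  ext i j
  simp [genericMatrix, entriesMatrix]

lemma aeval_det_genericMatrix (A : Fin d × Fin m → F) (N : Matrix (Fin m) (Fin d) K) :
    MvPolynomial.aeval A (Matrix.det (genericMatrix K d m *
      (N.map MvPolynomial.C : Matrix (Fin m) (Fin d) (MvPolynomial (Fin d × Fin m) K)))) =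
      Matrix.det (entriesMatrix A * N.map (algebraMap K F)) := by
  rw [AlgHom.map_det, AlgHom.mapMatrix_apply, Matrix.map_mul, genericMatrix_map_aeval,
    Matrix.map_map]
  congr 3
  ext; simp

lemma aeval_rowDefect_genericMatrix (A : Fin d × Fin m → F) (N : Matrix (Fin m) (Fin d) K)
    (q : Fin m → MvPolynomial (Fin d × Fin m) K) (j : Fin m) :
    MvPolynomial.aeval A (rowDefect (genericMatrix K d m) (N.map MvPolynomial.C) q j) =
      rowDefect (entriesMatrix A) (N.map (algebraMap K F))
        (fun j => MvPolynomial.aeval A (q j)) j := by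
  have h := congrFun (map_rowDefect (MvPolynomial.aeval (R := K) A).toRingHom
    (genericMatrix K d m) (N.map MvPolynomial.C) q) j
  have h₁ : (genericMatrix K d m).map (MvPolynomial.aeval (R := K) A).toRingHom =
      entriesMatrix A := genericMatrix_map_aeval A
  have h₂ : (N.map MvPolynomial.C).map (MvPolynomial.aeval (R := K) A).toRingHom =
      N.map (algebraMap K F) := by
    ext; simp
  rw [h₁, h₂] at h
  exact h

lemma map_algebraMap_self (N : Matrix (Fin m) (Fin d) K) : N.map (algebraMap K K) = N := by
  ext; simp

/-- Here and below `hA` says that `A` is a generic point of `V`: a polynomial over `K` vanishes at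
`A` exactly when it vanishes on `V`. This determinant is such a polynomial, and it equals `1` at
`a`. -/
lemma det_ne_zero_of_generic {V : Set (Fin d × Fin m → K)} {A : Fin d × Fin m → F}
    (hA : ∀ p : MvPolynomial (Fin d × Fin m) K, MvPolynomial.aeval A p = 0 ↔
      p ∈ MvPolynomial.vanishingIdeal K V) {a : Fin d × Fin m → K} (ha : a ∈ V)
    {N : Matrix (Fin m) (Fin d) K} (hN : entriesMatrix a * N = 1) :
    Matrix.det (entriesMatrix A * N.map (algebraMap K F)) ≠ 0 := by
  rw [← aeval_det_genericMatrix, Ne, hA]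
  intro h
  have := h a ha
  rw [aeval_det_genericMatrix, map_algebraMap_self, hN, Matrix.det_one] at this
  exact one_ne_zero this

/-- A membership in the row space that holds at the generic point holds at all points of full
rank. -/
lemma mem_rowSpan_of_generic (b : Basis (Fin m) K L) (b' : Basis (Fin m) F M)
    {V : Set (Fin d × Fin m → K)} {A : Fin d × Fin m → F}
    (hA : ∀ p : MvPolynomial (Fin d × Fin m) K, MvPolynomial.aeval A p = 0 ↔
      p ∈ MvPolynomial.vanishingIdeal K V) {a : Fin d × Fin m → K} (ha : a ∈ V)
    (hli : LinearIndependent K (rowVec b a)) {q : Fin m → MvPolynomial (Fin d × Fin m) K}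
    (hq : ∑ j, MvPolynomial.aeval A (q j) • b' j ∈ rowSpan b' A) :
    ∑ j, MvPolynomial.aeval a (q j) • b j ∈ rowSpan b a := by
  obtain ⟨N, hN⟩ := (linearIndependent_rowVec_iff b a).1 hli
  obtain ⟨c, hc⟩ := (mem_rowSpan_iff b' A _).1 hq
  refine (mem_rowSpan_iff b a _).2
    (exists_vecMul_eq_of_rowDefect_eq_zero (N := N) (by rw [hN, Matrix.det_one]; exact one_ne_zero)
      (funext fun j => ?_))
  have h := aeval_rowDefect_genericMatrix A N q j
  rw [← hc, rowDefect_eq_zero_of_mem, Pi.zero_apply, hA] at h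
  have := h a ha
  rwa [aeval_rowDefect_genericMatrix, map_algebraMap_self] at this

/-- A membership in the row space that holds at all points of full rank holds at the generic
point. -/
lemma generic_mem_rowSpan (b : Basis (Fin m) K L) (b' : Basis (Fin m) F M)
    {V : Set (Fin d × Fin m → K)} {A : Fin d × Fin m → F}
    (hA : ∀ p : MvPolynomial (Fin d × Fin m) K, MvPolynomial.aeval A p = 0 ↔
      p ∈ MvPolynomial.vanishingIdeal K V) {a₀ : Fin d × Fin m → K} (ha₀ : a₀ ∈ V)
    (hli : LinearIndependent K (rowVec b a₀)) {q : Fin m → MvPolynomial (Fin d × Fin m) K}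
    (hq : ∀ a ∈ V, LinearIndependent K (rowVec b a) →
      ∑ j, MvPolynomial.aeval a (q j) • b j ∈ rowSpan b a) :
    ∑ j, MvPolynomial.aeval A (q j) • b' j ∈ rowSpan b' A := by
  obtain ⟨N, hN⟩ := (linearIndependent_rowVec_iff b a₀).1 hli
  have hdet := det_ne_zero_of_generic hA ha₀ hN
  refine (mem_rowSpan_iff b' A _).2
    (exists_vecMul_eq_of_rowDefect_eq_zero (N := N.map (algebraMap K F)) hdet (funext fun j => ?_))
  -- The determinant factor makes the product vanish also at the points of `V` where the minor given
  -- by `N` degenerates and `hq` may say nothing.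
  have h : Matrix.det (genericMatrix K d m *
      (N.map MvPolynomial.C : Matrix (Fin m) (Fin d) (MvPolynomial (Fin d × Fin m) K))) *
      rowDefect (genericMatrix K d m) (N.map MvPolynomial.C) q j ∈
      MvPolynomial.vanishingIdeal K V := by
    intro a ha
    rw [map_mul, aeval_det_genericMatrix, aeval_rowDefect_genericMatrix, map_algebraMap_self,
      mul_eq_zero, or_iff_not_imp_left]
    intro h
    obtain ⟨c, hc⟩ := (mem_rowSpan_iff b a _).1
      (hq a ha (linearIndependent_rowVec_of_det_ne_zero b h))
    rw [← hc, rowDefect_eq_zero_of_mem, Pi.zero_apply]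
  rw [← hA, map_mul, aeval_det_genericMatrix, aeval_rowDefect_genericMatrix] at h
  exact (mul_eq_zero.1 h).resolve_left hdet

lemma generic_linearIndependent (b : Basis (Fin m) K L) (b' : Basis (Fin m) F M)
    {V : Set (Fin d × Fin m → K)} {A : Fin d × Fin m → F}
    (hA : ∀ p : MvPolynomial (Fin d × Fin m) K, MvPolynomial.aeval A p = 0 ↔
      p ∈ MvPolynomial.vanishingIdeal K V) {a₀ : Fin d × Fin m → K} (ha₀ : a₀ ∈ V)
    (hli : LinearIndependent K (rowVec b a₀)) : LinearIndependent F (rowVec b' A) := by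
  obtain ⟨N, hN⟩ := (linearIndependent_rowVec_iff b a₀).1 hli
  exact linearIndependent_rowVec_of_det_ne_zero b' (det_ne_zero_of_generic hA ha₀ hN)

/-- The coordinates of the bracket of two rows of the generic matrix. -/
noncomputable def genericBracket (b : Basis (Fin m) K L) (i j : Fin d) (l : Fin m) :
    MvPolynomial (Fin d × Fin m) K :=
  ∑ r, ∑ s, MvPolynomial.X (i, r) * MvPolynomial.X (j, s) * MvPolynomial.C (b.repr ⁅b r, b s⁆ l)

lemma sum_aeval_genericBracket (b : Basis (Fin m) K L) (b' : Basis (Fin m) F M)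
    (hb : ∀ r s, ⁅b' r, b' s⁆ = ∑ l, algebraMap K F (b.repr ⁅b r, b s⁆ l) • b' l)
    (A : Fin d × Fin m → F) (i j : Fin d) :
    ∑ l, MvPolynomial.aeval A (genericBracket b i j l) • b' l =
      ⁅rowVec b' A i, rowVec b' A j⁆ := by
  simp only [rowVec, sum_lie, lie_sum, smul_lie, lie_smul, hb, genericBracket, map_sum, map_mul,
    MvPolynomial.aeval_X, Finset.sum_smul, Finset.smul_sum, smul_smul,
    MvPolynomial.aeval_C]
  conv_rhs => rw [Finset.sum_comm]
  rw [Finset.sum_comm]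
  refine Finset.sum_congr rfl fun r _ => ?_
  rw [Finset.sum_comm]
  refine Finset.sum_congr rfl fun s _ => Finset.sum_congr rfl fun l _ => ?_
  ring_nf

end GenericPoint

/-! ### Subspaces of given codimension, and the kernel of a realization -/

section Codimension

open scoped TensorProduct

variable {K F L : Type*} [Field K] [Field F] [Algebra K F] [LieRing L] [LieAlgebra K L] {m k : ℕ}

/-- A subspace of codimension `k` of `F ⊗ L` is the kernel of a map `F ⊗ L → F ^ k` sending some
`k` basis vectors of `L` to the standard basis. -/
lemma exists_extendPi_eq_zero_iff (b : Basis (Fin m) K L) {W : Submodule F (F ⊗[K] L)}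
    (hW : finrank F ((F ⊗[K] L) ⧸ W) = k) {ι : Type*} [DecidableEq ι] [Fintype ι]
    (hι : Fintype.card ι = k) :
    ∃ (p : L →ₗ[K] (ι → F)) (s : ι → Fin m), (∀ i, p (b (s i)) = Pi.single i 1) ∧
      ∀ x, extendPi p F x = 0 ↔ x ∈ W := by
  have := Module.Finite.of_basis (b.baseChange F)
  let f (j : Fin m) : (F ⊗[K] L) ⧸ W := W.mkQ (b.baseChange F j)
  have hf : Submodule.span F (Set.range f) = ⊤ := by
    have : Set.range f = W.mkQ '' Set.range (b.baseChange F) := Set.range_comp _ _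
    rw [this, Submodule.span_image, Basis.span_eq, Submodule.map_top, Submodule.range_mkQ]
  obtain ⟨g, hg, hspan, hli⟩ := Submodule.exists_fun_fin_finrank_span_eq F (Set.range f)
  choose s hs using hg
  have hcard : Fintype.card ι = Fintype.card
      (Fin (finrank F (Submodule.span F (Set.range f)))) := by
    rw [hι, Fintype.card_fin, hf, finrank_top, hW]
  let β : Basis ι F ((F ⊗[K] L) ⧸ W) :=
    (Basis.mk hli (hspan.trans hf).ge).reindex (Fintype.equivOfCardEq hcard).symm
  let p : L →ₗ[K] (ι → F) := (β.equivFun.toLinearMap.restrictScalars K).comp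
    ((W.mkQ.restrictScalars K).comp (TensorProduct.mk K F L 1))
  have hp (x : F ⊗[K] L) : extendPi p F x = β.equivFun (W.mkQ x) := by
    induction x with
    | zero => simp
    | add x y hx hy => simp only [map_add, hx, hy]
    | tmul r v =>
      have h : r ⊗ₜ[K] v = r • (1 ⊗ₜ v) := by simp [TensorProduct.smul_tmul']
      rw [h, map_smul, map_smul, map_smul]
      congr 1
      ext i
      simp [p]
  refine ⟨p, fun i => s (Fintype.equivOfCardEq hcard i), fun i => ?_, fun x => ?_⟩
  · have h : W.mkQ ((1 : F) ⊗ₜ[K] b (s (Fintype.equivOfCardEq hcard i))) = β i := by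
      rw [← Basis.baseChange_apply]
      exact (hs _).trans (by simp [β])
    change β.equivFun (W.mkQ _) = _
    rw [TensorProduct.mk_apply, h]
    ext j
    simp [Pi.single_apply, eq_comm]
  · rw [hp, LinearEquiv.map_eq_zero_iff, Submodule.mkQ_apply, Submodule.Quotient.mk_eq_zero]

/-- A subspace of codimension `k` of `F ⊗ L` is the row space of a matrix in echelon form. -/
lemma exists_rowSpan_eq (b : Basis (Fin m) K L) {W : Submodule F (F ⊗[K] L)}
    (hW : finrank F ((F ⊗[K] L) ⧸ W) = k) :
    ∃ (A : Fin (m - k) × Fin m → F) (N : Matrix (Fin m) (Fin (m - k)) K),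
      rowSpan (b.baseChange F) A = W ∧ entriesMatrix A * N.map (algebraMap K F) = 1 := by
  have := Module.Finite.of_basis (b.baseChange F)
  have hfin : finrank F (F ⊗[K] L) = m := by
    rw [finrank_eq_card_basis (b.baseChange F), Fintype.card_fin]
  obtain ⟨p, s, hs, hp⟩ := exists_extendPi_eq_zero_iff b hW (Fintype.card_fin k)
  have hinj : Function.Injective s := fun i j hij => by
    have h := hs i
    rw [hij, hs j] at h
    by_contra hne
    have := congrFun h i
    simp [hne] at this
  have hcard : Fintype.card {j // j ∉ Set.range s} = m - k := by
    rw [Fintype.card_subtype_compl, Fintype.card_fin, Set.card_range_of_injective hinj,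
      Fintype.card_fin]
  let u := (Fintype.equivFinOfCardEq hcard).symm
  have hu (i : Fin (m - k)) (l : Fin k) : (u i : Fin m) ≠ s l := fun h => (u i).2 ⟨l, h.symm⟩
  -- The `s l` index basis vectors spanning a complement of `W` and the `u i` are the remaining
  -- indices. Row `i` is `b (u i)` minus its component in that complement; `N` selects the columns
  -- `u i`, hence has entries in `K`.
  let A : Fin (m - k) × Fin m → F := fun x => (if x.2 = u x.1 then 1 else 0) -
    ∑ l, if x.2 = s l then p (b (u x.1)) l else 0
  let N : Matrix (Fin m) (Fin (m - k)) K := Matrix.of fun j i => if j = u i then 1 else 0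
  have hAN : entriesMatrix A * N.map (algebraMap K F) = 1 := by
    ext i j
    have : (u j : Fin m) = u i ↔ i = j := by
      rw [Subtype.val_inj, u.injective.eq_iff, eq_comm]
    simp [Matrix.mul_apply, entriesMatrix, N, A, apply_ite (algebraMap K F), hu, this,
      Matrix.one_apply]
  refine ⟨A, N, ?_, hAN⟩
  have hle : rowSpan (b.baseChange F) A ≤ W := by
    rw [rowSpan, Submodule.span_le]
    rintro _ ⟨i, rfl⟩
    rw [SetLike.mem_coe, ← hp]
    have h (j : Fin m) : extendPi p F (b.baseChange F j) = p (b j) := by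
      ext l; simp
    have hrow : rowVec (b.baseChange F) A i = b.baseChange F (u i) -
        ∑ l, p (b (u i)) l • b.baseChange F (s l) := by
      simp only [rowVec, A, sub_smul, Finset.sum_sub_distrib, ite_smul, one_smul, zero_smul,
        Finset.sum_ite_eq', Finset.mem_univ, if_true, Finset.sum_smul]
      rw [Finset.sum_comm]
      simp only [Finset.sum_ite_eq', Finset.mem_univ, if_true]
    simp only [hrow, map_sub, map_sum, map_smul, h, hs]
    rw [sub_eq_zero]
    ext l
    simp [Finset.sum_apply, Pi.single_apply]
  refine Submodule.eq_of_le_of_finrank_eq hle ?_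
  have hli : LinearIndependent F (rowVec (b.baseChange F) A) :=
    (linearIndependent_rowVec_iff _ _).2 ⟨_, hAN⟩
  have h := W.finrank_quotient_add_finrank
  rw [rowSpan, finrank_span_eq_card hli, Fintype.card_fin]
  omega

/-- The relations between the images of a realization form a Lie subalgebra. -/
lemma exists_lie_mem_of_realization {R : Type*} [Field R] [Algebra K R]
    (φ : L →ₗ⁅K⁆ Derivation K R R)
    (hφ : Function.Injective φ) (hk : Module.rank R (Submodule.span R (Set.range φ)) = k) :
    ∃ W : Submodule R (R ⊗[K] L), (∀ x ∈ W, ∀ y ∈ W, ⁅x, y⁆ ∈ W) ∧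
      finrank R ((R ⊗[K] L) ⧸ W) = k ∧ ∀ v : L, (1 : R) ⊗ₜ[K] v ∈ W → v = 0 := by
  let Φ : R ⊗[K] L →ₗ[R] Derivation K R R := LinearMap.liftBaseChange R (φ : L →ₗ[K] _)
  have hΦ (r : R) (v : L) : Φ (r ⊗ₜ v) = r • φ v := by simp [Φ]
  -- `Φ` respects brackets only up to the Leibniz terms from differentiating coefficients, and these
  -- vanish when `Φ x = Φ y = 0`.
  have hlie (x y : R ⊗[K] L) : Φ ⁅x, y⁆ = ⁅Φ x, Φ y⁆ -
      Φ ((Φ x : R →ₗ[K] R).rTensor L y) + Φ ((Φ y : R →ₗ[K] R).rTensor L x) := by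
    induction x with
    | zero => simp
    | add x₁ x₂ h₁ h₂ =>
      simp only [add_lie, map_add, h₁, h₂, Derivation.coe_add_linearMap, LinearMap.rTensor_add,
        LinearMap.add_apply]
      abel
    | tmul r u =>
      induction y with
      | zero => simp
      | add y₁ y₂ h₁ h₂ =>
        simp only [lie_add, map_add, h₁, h₂, Derivation.coe_add_linearMap, LinearMap.rTensor_add,
          LinearMap.add_apply]
        abel
      | tmul t v =>
        ext z
        simp [hΦ, LieAlgebra.ExtendScalars.bracket_tmul, Derivation.commutator_apply]
        ring
  refine ⟨LinearMap.ker Φ, fun x hx y hy => ?_, ?_, fun v hv => ?_⟩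
  · rw [LinearMap.mem_ker] at hx hy ⊢
    rw [hlie, hx, hy]
    simp
  · have hrange : LinearMap.range Φ = Submodule.span R (Set.range φ) := by
      refine le_antisymm ?_ ?_
      · rintro _ ⟨x, rfl⟩
        induction x with
        | zero => simp
        | add x y hx hy => rw [map_add]; exact add_mem hx hy
        | tmul r v => rw [hΦ]; exact Submodule.smul_mem _ _ (Submodule.subset_span ⟨v, rfl⟩)
      · rw [Submodule.span_le]
        rintro _ ⟨v, rfl⟩
        exact ⟨1 ⊗ₜ v, by simp [hΦ]⟩
    rw [Φ.quotKerEquivRange.finrank_eq, hrange]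
    exact finrank_eq_of_rank_eq hk
  · rw [LinearMap.mem_ker, hΦ, one_smul] at hv
    exact hφ (hv.trans (map_zero φ).symm)

end Codimension

/-! ### Subalgebras of `F ⊗ L` versus subvarieties, and the theorem -/

section Main

open scoped TensorProduct

variable {K : Type u} {L : Type v} [Field K] [LieRing L] [LieAlgebra K L] {m k : ℕ}

lemma baseChange_lie (b : Basis (Fin m) K L) (F : Type*) [Field F] [Algebra K F] (r s : Fin m) :
    ⁅b.baseChange F r, b.baseChange F s⁆ =
      ∑ l, algebraMap K F (b.repr ⁅b r, b s⁆ l) • b.baseChange F l := by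
  simp only [Basis.baseChange_apply, LieAlgebra.ExtendScalars.bracket_tmul, algebraMap_smul,
    ← TensorProduct.tmul_smul, ← TensorProduct.tmul_sum, b.sum_repr, mul_one]

lemma sum_aeval_C (b : Basis (Fin m) K L) (F : Type*) [Field F] [Algebra K F] (v : L)
    {σ : Type*} (A : σ → F) :
    ∑ j, MvPolynomial.aeval (R := K) A (MvPolynomial.C (b.repr v j)) • b.baseChange F j =
      1 ⊗ₜ v := by
  simp only [Basis.baseChange_apply, MvPolynomial.aeval_C, algebraMap_smul,
    ← TensorProduct.tmul_smul, ← TensorProduct.tmul_sum, b.sum_repr]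

lemma hasSeparatingSubvariety_of_codim [IsAlgClosed K] (b : Basis (Fin m) K L) {F : Type*} [Field F]
    [Algebra K F] {W : Submodule F (F ⊗[K] L)} (hlie : ∀ x ∈ W, ∀ y ∈ W, ⁅x, y⁆ ∈ W)
    (hW : finrank F ((F ⊗[K] L) ⧸ W) = k) (hinj : ∀ v : L, (1 : F) ⊗ₜ[K] v ∈ W → v = 0) :
    HasSeparatingSubvariety b k := by
  have := Module.Finite.of_basis (b.baseChange F)
  have hkm : k ≤ m := by
    rw [← hW, ← Fintype.card_fin m, ← finrank_eq_card_basis (b.baseChange F)]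
    exact W.finrank_quotient_le
  obtain ⟨A, N, hAW, hAN⟩ := exists_rowSpan_eq b hW
  -- `P` consists of all relations over `K` between the entries of `A`, so `A` is a generic point of
  -- its zero locus.
  let P : Ideal (MvPolynomial (Fin (m - k) × Fin m) K) :=
    RingHom.ker (MvPolynomial.aeval (R := K) A)
  have hP : P.IsPrime := RingHom.ker_isPrime _
  let V := MvPolynomial.zeroLocus K P
  have hV : IsIrreducibleVariety V := isIrreducibleVariety_zeroLocus P
  have hA (p : MvPolynomial (Fin (m - k) × Fin m) K) : MvPolynomial.aeval A p = 0 ↔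
      p ∈ MvPolynomial.vanishingIdeal K V := by
    rw [MvPolynomial.IsPrime.vanishingIdeal_zeroLocus (K := K) P]
    rfl
  have hli (a : Fin (m - k) × Fin m → K) (ha : a ∈ V) : LinearIndependent K (rowVec b a) := by
    rw [linearIndependent_rowVec_iff]
    refine ⟨N, ?_⟩
    ext i j
    -- As `N` has entries in `K`, the equations `A * N = 1` belong to `P` and persist on all of `V`;
    -- hence `V` avoids the degenerate matrices entirely.
    let p : MvPolynomial (Fin (m - k) × Fin m) K :=
      ∑ l, MvPolynomial.X (i, l) * MvPolynomial.C (N l j) -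
        MvPolynomial.C ((1 : Matrix (Fin (m - k)) (Fin (m - k)) K) i j)
    have hp : p ∈ P := by
      have := congrFun (congrFun hAN i) j
      simp only [Matrix.mul_apply, entriesMatrix, Matrix.of_apply, Matrix.map_apply] at this
      rw [RingHom.mem_ker]
      simp [p, this, Matrix.one_apply]
    have := ha p hp
    simp only [p, map_sub, map_sum, map_mul, MvPolynomial.aeval_X, MvPolynomial.aeval_C,
      Algebra.algebraMap_self, RingHom.id_apply, sub_eq_zero] at this
    exact this
  have hsub : V ⊆ subalgebraBases b k := by
    refine fun a ha => ⟨hkm, (exists_lieSubalgebra_eq_rowSpan_iff b a).2 fun i j => ?_⟩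
    rw [← sum_aeval_genericBracket b b (by simp [b.sum_repr]) a i j]
    refine mem_rowSpan_of_generic b (b.baseChange F) hA ha (hli a ha) ?_
    rw [sum_aeval_genericBracket b _ (baseChange_lie b F)]
    have h (i) : rowVec (b.baseChange F) A i ∈ W := hAW ▸ Submodule.subset_span ⟨i, rfl⟩
    exact hAW ▸ hlie _ (h i) _ (h j)
  obtain ⟨a₀, ha₀⟩ := hV.2.1
  refine ⟨V, hV, hsub, fun h => (h ha₀).2 (hli a₀ ha₀), ?_⟩
  rw [eq_bot_iff]
  intro v hv
  simp only [Submodule.mem_iInf] at hv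
  refine hinj v ?_
  rw [← hAW, ← sum_aeval_C b F v A]
  refine generic_mem_rowSpan b _ hA ha₀ (hli a₀ ha₀) fun a ha h => ?_
  have := hv a ⟨ha, fun h' => h'.2 h⟩
  simpa [b.sum_repr] using this

lemma exists_codim_of_hasSeparatingSubvariety (b : Basis (Fin m) K L)
    (h : HasSeparatingSubvariety b k) :
    ∃ (F : Type u) (_ : Field F) (_ : Algebra K F) (W : Submodule F (F ⊗[K] L)),
      (∀ x ∈ W, ∀ y ∈ W, ⁅x, y⁆ ∈ W) ∧ finrank F ((F ⊗[K] L) ⧸ W) = k ∧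
        ∀ v : L, (1 : F) ⊗ₜ[K] v ∈ W → v = 0 := by
  obtain ⟨V, hV, hsub, hnot, hinf⟩ := h
  obtain ⟨a₀, ha₀, ha₀'⟩ := Set.not_subset.1 hnot
  have hkm : k ≤ m := (hsub ha₀).1
  have hli {a} (ha : a ∈ V) (ha' : a ∉ degenerateSubalgebraBases b k) :
      LinearIndependent K (rowVec b a) := not_not.1 fun h => ha' ⟨hsub ha, h⟩
  let P := MvPolynomial.vanishingIdeal K V
  have hP : P.IsPrime := hV.isPrime_vanishingIdeal
  -- The function field of `V`; the classes of the coordinates form the generic point `A`.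
  let F := FractionRing (MvPolynomial (Fin (m - k) × Fin m) K ⧸ P)
  let ev : MvPolynomial (Fin (m - k) × Fin m) K →ₐ[K] F :=
    (IsScalarTower.toAlgHom K (MvPolynomial (Fin (m - k) × Fin m) K ⧸ P) F).comp
      (Ideal.Quotient.mkₐ K P)
  let A : Fin (m - k) × Fin m → F := fun x => ev (MvPolynomial.X x)
  have hev : MvPolynomial.aeval A = ev := MvPolynomial.algHom_ext fun x => by simp [A]
  have hA (p : MvPolynomial (Fin (m - k) × Fin m) K) : MvPolynomial.aeval A p = 0 ↔
      p ∈ MvPolynomial.vanishingIdeal K V := by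
    rw [hev]
    change algebraMap _ F (Ideal.Quotient.mk P p) = 0 ↔ p ∈ P
    rw [map_eq_zero_iff _ (IsFractionRing.injective _ F), Ideal.Quotient.eq_zero_iff_mem]
  have hA₀ := generic_linearIndependent b (b.baseChange F) hA ha₀ (hli ha₀ ha₀')
  have hsubalg : ∃ H : LieSubalgebra F (F ⊗[K] L), H.toSubmodule = rowSpan (b.baseChange F) A := by
    rw [exists_lieSubalgebra_eq_rowSpan_iff]
    intro i j
    rw [← sum_aeval_genericBracket b _ (baseChange_lie b F)]
    refine generic_mem_rowSpan b _ hA ha₀ (hli ha₀ ha₀') fun a ha _ => ?_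
    rw [sum_aeval_genericBracket b b (by simp [b.sum_repr])]
    exact (exists_lieSubalgebra_eq_rowSpan_iff b a).1 (hsub ha).2 i j
  obtain ⟨H, hH⟩ := hsubalg
  refine ⟨F, inferInstance, inferInstance, H.toSubmodule, fun x hx y hy => H.lie_mem hx hy, ?_,
    fun v hv => ?_⟩
  · have := Module.Finite.of_basis (b.baseChange F)
    have h := H.toSubmodule.finrank_quotient_add_finrank
    rw [finrank_eq_card_basis (b.baseChange F), Fintype.card_fin] at h
    have h' : finrank F H.toSubmodule = m - k := by
      rw [hH, rowSpan, finrank_span_eq_card hA₀, Fintype.card_fin]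
    omega
  · rw [hH, ← sum_aeval_C b F v A] at hv
    have : v ∈ (⊥ : Submodule K L) := by
      rw [← hinf]
      simp only [Submodule.mem_iInf]
      rintro a ⟨ha, ha'⟩
      have := mem_rowSpan_of_generic b _ hA ha (hli ha ha') hv
      simpa [b.sum_repr] using this
    simpa using this

end Main

theorem mainTheorem1 {K : Type u} {L : Type v} [Field K] [IsAlgClosed K]
    [LieRing L] [LieAlgebra K L] [FiniteDimensional K L]
    {m : ℕ} (b : Basis (Fin m) K L) (k : ℕ) :
    (HasFieldRealization.{u, v, w} K L k → HasSeparatingSubvariety b k) ∧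
      (CharZero K → (HasFieldRealization.{u, v, w} K L k ↔ HasSeparatingSubvariety b k)) := by
  have h : HasFieldRealization.{u, v, w} K L k → HasSeparatingSubvariety b k := by
    rintro ⟨R, _, _, φ, hφ, hk⟩
    obtain ⟨W, hlie, hW, hinj⟩ := exists_lie_mem_of_realization φ hφ hk
    exact hasSeparatingSubvariety_of_codim b hlie hW hinj
  refine ⟨h, fun _ => ⟨h, fun hV => ?_⟩⟩
  obtain ⟨F, _, _, W, hlie, hW, hinj⟩ := exists_codim_of_hasSeparatingSubvariety b hV
  -- Indexing the polynomial variables by a lifted type places the constructed field in the universe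
  -- `max u w`.
  have hcard : Fintype.card (ULift.{w} (Fin k)) = k := by simp
  obtain ⟨p, s, hs, hp⟩ := exists_extendPi_eq_zero_iff b hW hcard
  have := hasFieldRealization_of_extendPi.{u, v, w} (p := p) (e := fun i => b (s i)) hs
    (fun x y hx hy => (hp _).2 (hlie x ((hp x).1 hx) y ((hp y).1 hy)))
    (fun v hv => hinj v ((hp _).1 (funext fun i => by simp [hv])))
  rwa [hcard] at this
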